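/- Let $I=\mathbb Z_+$ or $I=\mathbb R_+$, let $E$ be a metric space with its Borel $\sigma$-algebra $\mathcal E$, and let $(X_t)_{t\in I}$ be an $E$-valued time-homogeneous Markov process with laws $(\mathbb P_x)_{x\in E}$ (measurable in $x$, with $\mathbb P_x(X_0=x)=1$) on a space $\Omega$ carrying the time shifts (for instance a path space closed under shifts). Let $\mathcal F_t=\sigma(X_s,\,s\le t)$ and $\mathbb P_\mu=\int\mathbb P_x\,\mu(dx)$; for $F\in\mathcal E$ let $\mathcal M_1(F)$ be the set of probability measures carried by $F$. Let $(A_t)_{t\in I}$ be sets in $\mathcal E$, and put $E_t=E\setminus A_t$, $A_\infty=\bigcap_{t\in I}A_t$, $E_\infty=E\setminus A_\infty$, $$\tau_{A\circ\theta_s}=\inf\{t\in I: X_t\in A_{s+t}\},\qquad \tau_A=\tau_{A\circ\theta_0},\qquad \tau_{A_\infty}=\inf\{t\in I: X_t\in A_\infty\}$$ (with $\inf\emptyset=\infty$); for $\tau$ any of these times, the events $\{\tau<t\}$ are assumed to belong to $\mathcal F_t$. Assume that $\mathbb P_x(\tau_{A\circ\theta_s}<\infty)=1$ and $\mathbb P_x(\tau_{A\circ\theta_s}>t)>0$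 for all $s,t\in I$ and $x\in E_s$, that $A_t\subset A_s$ for $s\le t$, that $A_\infty\ne\emptyset$, and the following. (1) There are $\nu_s\in\mathcal M_1(E_s)$ ($s\in I$), $t_0\in I$ with $t_0>0$, and $c_1,c_2>0$ such that for all $s,t\in I$ and $x\in E_s$: $\mathbb P_x(X_{t_0}\in\cdot\mid\tau_{A\circ\theta_s}>t_0)\ge c_1\nu_{s+t_0}$ and $\mathbb P_{\nu_s}(\tau_{A\circ\theta_s}>t)\ge c_2\,\mathbb P_x(\tau_{A\circ\theta_s}>t)$. (2a) (Strong Markov property) For every $(\mathcal F_t)$-stopping time $\tau$ and every $x\in E$, $\mathbb P_x((X_{\tau+t})_{t\in I}\in\cdot,\ \tau<\infty\mid\mathcal F_\tau)=\mathbf 1_{\tau<\infty}\,\mathbb P_{X_\tau}((X_t)_{t\in I}\in\cdot)$. (2b) For every $x\in E_0$, $\tau_{A\circ\theta_s}$ converges in law to $\tau_{A_\infty}$ under $\mathbb P_x$ as $s\to\infty$. (2c) For all $x\in E_0$ and $s\in I$, the functions $t\mapsto\mathbb P_x(\tau_{A\circ\theta_s}>t)$ and $t\mapsto\mathbb P_x(\tau_{A_\infty}>t)$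 are continuous on $I$. (2d) For every $t\in I$ with $t>0$, the function $x\mapsto\mathbb P_x(\tau_{A_\infty}>t)$ is continuous on $E$. (3) There are $\nu_\infty\in\mathcal M_1(E_\infty)$, $t_\infty\in I$ and $c_{1,\infty},c_{2,\infty}>0$ such that for all $x\in E_\infty$ and $t\in I$: $\mathbb P_x(X_{t_\infty}\in\cdot\mid\tau_{A_\infty}>t_\infty)\ge c_{1,\infty}\nu_\infty$ and $\mathbb P_{\nu_\infty}(\tau_{A_\infty}>t)\ge c_{2,\infty}\,\mathbb P_x(\tau_{A_\infty}>t)$. Then there is a probability measure $\alpha\in\mathcal M_1(E_\infty)$ such that for every $\mu\in\mathcal M_1(E_0)$ $$\mathbb P_\mu(X_t\in\cdot\mid\tau_A>t)\longrightarrow\alpha\quad\text{weakly as }t\to\infty.$$ Moreover, $\alpha$ is the unique quasi-limiting distribution (the only probability measure on $E$ that is the weak limit of $\mathbb P_\mu(X_t\in\cdot\mid\tau_A>t)$ for some $\mu\in\mathcal M_1(E_0)$), and $\alpha$ is the unique quasi-stationary distribution for absorption at $A_\infty$ (the only probability measure on $E$ with $\mathbb P_\alpha(X_t\in\cdot\mid\tau_{A_\infty}>t)=\alpha$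 for all $t\in I$). -/

import Mathlib

open MeasureTheory ProbabilityTheory Filter Topology
open scoped NNReal ENNReal BoundedContinuousFunction

noncomputable section

/-- The time set is `ℤ₊` or `ℝ₊`, seen inside `ℝ₊`. -/
def IsTimeSet (I : AddSubmonoid ℝ≥0) : Prop :=
  I = AddMonoidHom.mrange (Nat.castAddMonoidHom ℝ≥0) ∨ I = ⊤

/-- The filtration `𝓕 t = σ(X s, s ≤ t)` generated by a process. -/
def pathFiltration {I : AddSubmonoid ℝ≥0} {E Ω : Type*} [MeasurableSpace E]
    [mΩ : MeasurableSpace Ω] (X : I → Ω → E) (hX : ∀ t, Measurable (X t)) : Filtration I mΩ where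
  seq t := ⨆ s : I, ⨆ _ : s ≤ t, MeasurableSpace.comap (X s) inferInstance
  mono' := fun _ _ htu => iSup₂_le fun s hs =>
    le_iSup₂ (f := fun (r : I) (_ : r ≤ _) => MeasurableSpace.comap (X r) inferInstance)
      s (hs.trans htu)
  le' := fun _ => iSup₂_le fun s _ => (hX s).comap_le

/-- A time-homogeneous Markov process `(X t)` on `E`, with the laws `P x` of the process started
from `x`. As usual `Ω` carries shift operators `θ u` with `X t ∘ θ u = X (u + t)` (as every path
space closed under time shifts does), so that path functionals such as hitting times, which need
not be measurable for the product σ-algebra, can be shifted. -/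
structure MarkovFamily (I : AddSubmonoid ℝ≥0) (E Ω : Type*) [MeasurableSpace E]
    [MeasurableSpace Ω] where
  /-- the process -/
  X : I → Ω → E
  /-- the family of laws `P x`, depending measurably on the starting point -/
  P : Kernel E Ω
  isMarkovKernel : IsMarkovKernel P
  measurable_X : ∀ t, Measurable (X t)
  shift : I → Ω → Ω
  X_shift : ∀ u t ω, X t (shift u ω) = X (u + t) ω
  start : ∀ x, P x {ω | X 0 ω = x} = 1
  markov : ∀ (x : E) (u : I) (C : Set (I → E)), MeasurableSet C →
    (P x)⟦{ω | (fun t => X (u + t) ω) ∈ C} | pathFiltration X measurable_X u⟧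
      =ᵐ[P x] fun ω => (P (X u ω)).real {ω' | (fun t => X t ω') ∈ C}

namespace MarkovFamily

variable {I : AddSubmonoid ℝ≥0} {E Ω : Type*} [MeasurableSpace E] [MeasurableSpace Ω]

instance (M : MarkovFamily I E Ω) : IsMarkovKernel M.P := M.isMarkovKernel

/-- The natural filtration of the process. -/
def filtration (M : MarkovFamily I E Ω) : Filtration I ‹MeasurableSpace Ω› :=
  pathFiltration M.X M.measurable_X

/-- `P_μ = ∫ P_x dμ(x)`. -/
def law (M : MarkovFamily I E Ω) (μ : Measure E) : Measure Ω := μ.bind M.P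

/-- The hitting time `inf {t ∈ I : X t ∈ B t}` of a moving set `B`, with `inf ∅ = ∞`. -/
def hit (M : MarkovFamily I E Ω) (B : I → Set E) (ω : Ω) : ℝ≥0∞ :=
  ⨅ t : I, ⨅ _ : M.X t ω ∈ B t, ((t : ℝ≥0) : ℝ≥0∞)

/-- The survival event `{τ_B > t}`. -/
def survives (M : MarkovFamily I E Ω) (B : I → Set E) (t : I) : Set Ω :=
  {ω | ((t : ℝ≥0) : ℝ≥0∞) < M.hit B ω}

/-- The conditional distribution `Q(X t ∈ · | τ_B > t)` for a law `Q` on `Ω`. -/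
def condLaw (M : MarkovFamily I E Ω) (B : I → Set E) (Q : Measure Ω) (t : I) : Measure E :=
  (Q[|M.survives B t]).map (M.X t)

/-- Measurability of hitting: whether `B` is hit before time `t` is an event of the past of `t`. -/
def HitMeasurable (M : MarkovFamily I E Ω) (B : I → Set E) : Prop :=
  ∀ t : I, MeasurableSet[M.filtration t] {ω | M.hit B ω < ((t : ℝ≥0) : ℝ≥0∞)}

/-- The strong Markov property, for all stopping times `τ` (with values in `I ∪ {∞}`) of the
natural filtration: conditionally on `𝓕_τ`, on `{τ < ∞}`, the process `(X (τ + t))` has the law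
of `X` under `P (X τ)`. -/
def StrongMarkov (M : MarkovFamily I E Ω) : Prop :=
  ∀ (τ : Ω → WithTop I) (hτ : IsStoppingTime M.filtration τ) (x : E) (C : Set (I → E)),
    MeasurableSet C →
    (M.P x)⟦{ω | (fun t => M.X ((τ ω).untopD 0 + t) ω) ∈ C ∧ τ ω ≠ ⊤} | hτ.measurableSpace⟧
      =ᵐ[M.P x] {ω | τ ω ≠ ⊤}.indicator
        fun ω => (M.P (M.X ((τ ω).untopD 0) ω)).real {ω' | (fun t => M.X t ω') ∈ C}

end MarkovFamily

/-- The moving set `A ∘ θ_s : t ↦ A (s + t)`. -/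
def shiftBoundary {I : AddSubmonoid ℝ≥0} {E : Type*} (A : I → Set E) (s : I) : I → Set E :=
  fun t => A (s + t)

/-- `A_∞ = ⋂ t, A t`. -/
def limitSet {I : AddSubmonoid ℝ≥0} {E : Type*} (A : I → Set E) : Set E := ⋂ t, A t

/-- `μ` is a probability measure carried by `F`, i.e. `μ ∈ 𝓜₁(F)`. -/
def IsProbOn {E : Type*} [MeasurableSpace E] (μ : Measure E) (F : Set E) : Prop :=
  IsProbabilityMeasure μ ∧ μ F = 1

/-- Weak convergence of `m t` to `α` as `t → ∞`, against bounded continuous functions. -/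
def WeakTendsto {I : AddSubmonoid ℝ≥0} {E : Type*} [TopologicalSpace E] [MeasurableSpace E]
    (m : I → Measure E) (α : Measure E) : Prop :=
  ∀ f : E →ᵇ ℝ, Tendsto (fun t => ∫ x, f x ∂(m t)) atTop (𝓝 (∫ x, f x ∂α))

namespace MarkovFamily

variable {I : AddSubmonoid ℝ≥0} {E Ω : Type*} [MeasurableSpace E] [MeasurableSpace Ω]

/-- The time-inhomogeneous Champagnat-Villemonais condition for the moving boundary `A`. -/
def MovingCV (M : MarkovFamily I E Ω) (A : I → Set E) : Prop :=
  ∃ (ν : I → Measure E) (t₀ : I) (c₁ c₂ : ℝ≥0),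
    (∀ s, IsProbOn (ν s) (A s)ᶜ) ∧ 0 < t₀ ∧ 0 < c₁ ∧ 0 < c₂ ∧
    (∀ s, ∀ x ∈ (A s)ᶜ, c₁ • ν (s + t₀) ≤ M.condLaw (shiftBoundary A s) (M.P x) t₀) ∧
    (∀ s t, ∀ x ∈ (A s)ᶜ,
      (c₂ : ℝ≥0∞) * M.P x (M.survives (shiftBoundary A s) t)
        ≤ M.law (ν s) (M.survives (shiftBoundary A s) t))

/-- The Champagnat-Villemonais conditions (A1) and (A2) for a fixed absorbing set `D`. -/
def FixedCV (M : MarkovFamily I E Ω) (D : Set E) : Prop :=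
  ∃ (ν : Measure E) (t₁ : I) (c₁ c₂ : ℝ≥0),
    IsProbOn ν Dᶜ ∧ 0 < c₁ ∧ 0 < c₂ ∧
    (∀ x ∈ Dᶜ, c₁ • ν ≤ M.condLaw (fun _ => D) (M.P x) t₁) ∧
    (∀ t, ∀ x ∈ Dᶜ, (c₂ : ℝ≥0∞) * M.P x (M.survives (fun _ => D) t)
      ≤ M.law ν (M.survives (fun _ => D) t))

/-- The strong Markov property, convergence in law of the hitting times `τ_{A ∘ θ_s}` to `τ_{A_∞}`
as `s → ∞`, and continuity of the survival probabilities in time and in the starting point. At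
`t = 0` continuity in the starting point is not asked for. -/
structure HittingRegularity [TopologicalSpace E] (M : MarkovFamily I E Ω) (A : I → Set E) :
    Prop where
  strongMarkov : M.StrongMarkov
  hit_tendsto : ∀ x ∈ (A 0)ᶜ,
    TendstoInDistribution (fun s : I => M.hit (shiftBoundary A s)) atTop
      (M.hit fun _ => limitSet A) (fun _ => M.P x) (M.P x)
  continuous_time : ∀ x ∈ (A 0)ᶜ, ∀ s,
    Continuous fun t : I => M.P x (M.survives (shiftBoundary A s) t)
  continuous_time_limit : ∀ x ∈ (A 0)ᶜ,
    Continuous fun t : I => M.P x (M.survives (fun _ => limitSet A) t)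
  continuous_state : ∀ t : I, 0 < t →
    Continuous fun x => M.P x (M.survives (fun _ => limitSet A) t)

/-- `α` is a quasi-limiting distribution for the moving boundary `A`: it is the limit of the
conditional laws for some initial law carried by `E_0`. -/
def IsQuasiLimiting [TopologicalSpace E] (M : MarkovFamily I E Ω) (A : I → Set E)
    (α : Measure E) : Prop :=
  ∃ μ : Measure E, IsProbOn μ (A 0)ᶜ ∧ WeakTendsto (M.condLaw A (M.law μ)) α

/-- `α` is a quasi-stationary distribution for absorption at the fixed set `D`. -/
def IsQuasiStationary (M : MarkovFamily I E Ω) (D : Set E) (α : Measure E) : Prop :=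
  ∀ t, M.condLaw (fun _ => D) (M.law α) t = α

end MarkovFamily

end

/-! Fix a measurable `C`. Condition (1) makes the conditioned process forget its start: for the
boundary `A ∘ θ_s`, the ratio `P_x(τ > n t₀, X_{n t₀} ∈ C) / P_x(τ > n t₀)` lies, for all admissible
`x`, in one interval of length `(1 - c₁ c₂) ^ n` that depends on `s`, `n`, `C` only
(`exists_bounds`). The induction on `n` uses the Markov property at `t₀`: the law of the surviving
position dominates `c₁` times its mass times `ν (s + t₀)`, and no starting point survives better
than `ν (s + t₀)` by a factor above `1 / c₂`. Hence a fraction `c₁ c₂` of the ratio is the ratio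
from `ν (s + t₀)`, whatever `x` is (`exists_contraction_of_minorization`).

For the constant boundary `A_∞`, with the constants of (3), the conditional laws are therefore
Cauchy uniformly over measurable sets. Their limit `α` is quasi-stationary by the Markov property
(`isQuasiStationary_limit`), and every quasi-stationary law equals it (`eq_limit`).

For the moving boundary, restart at time `s` and look at time `s + n t₀`: the conditional law from
`μ` gives `C` a mass in the same interval as the law from a fixed `x ∈ E_0` conditioned on avoiding
`A ∘ θ_s` up to `n t₀`. With `n` fixed and `s → ∞`, the latter approaches the law conditioned on
avoiding `A_∞`, because the hitting times converge in law; that one is near `α` for `n` large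
(`weakTendsto_condLaw`).

The delicate point is continuous time. The event `{τ > u}` need not belong to `𝓕_u`, so the Markov
property at `u` is applied to `noHit` instead. The two events differ by `defect` (no visit, yet `τ =
u`). Continuity of survival in time makes it null at positive times for starting points in `E_0`;
points reached later inherit this only almost surely, whence `good`. For a quasi-stationary law it
has to be proved (`law_defect`). -/

theorem le_add_right_self {I : AddSubmonoid ℝ≥0} (u t : I) : u ≤ u + t :=
  le_add_of_nonneg_right (α := ℝ≥0) (zero_le (a := (t : ℝ≥0)))

namespace IsTimeSet

variable {I : AddSubmonoid ℝ≥0}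

theorem exists_add_of_le (hI : IsTimeSet I) {a b : I} (hab : a ≤ b) : ∃ c, b = a + c := by
  have key : (b : ℝ≥0) - a ∈ I := by
    rcases hI with h | h
    · have ha := a.2
      have hb := b.2
      simp only [h, AddMonoidHom.mem_mrange, Nat.coe_castAddMonoidHom] at ha hb ⊢
      obtain ⟨m, hm⟩ := ha
      obtain ⟨n, hn⟩ := hb
      exact ⟨n - m, by rw [← hm, ← hn]; exact Nat.cast_tsub n m⟩
    · exact (SetLike.ext_iff.1 h _).2 (AddSubmonoid.mem_top _)
  refine ⟨⟨_, key⟩, Subtype.ext ?_⟩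
  exact (add_tsub_cancel_of_le (α := ℝ≥0) hab).symm

end IsTimeSet

theorem shiftBoundary_shiftBoundary {I : AddSubmonoid ℝ≥0} {E : Type*} (B : I → Set E) (s u : I) :
    shiftBoundary (shiftBoundary B s) u = shiftBoundary B (s + u) := by
  funext t; simp [shiftBoundary, add_assoc]

theorem shiftBoundary_zero {I : AddSubmonoid ℝ≥0} {E : Type*} 
    (B : I → Set E) : shiftBoundary B 0 = B := by
  funext t; simp [shiftBoundary]

theorem limitSet_subset_shiftBoundary {I : AddSubmonoid ℝ≥0} {E : Type*} (A : I → Set E) (s r : I) :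
    limitSet A ⊆ shiftBoundary A s r :=
  Set.iInter_subset A (s + r)

/-! ### Hitting events: measurability and behaviour under the shift -/

namespace MarkovFamily

variable {I : AddSubmonoid ℝ≥0} {E Ω : Type*} [MeasurableSpace E] [MeasurableSpace Ω]

/-- No visit to the moving set `B` during the closed time interval `[0, t]`. -/
def noHit (M : MarkovFamily I E Ω) (B : I → Set E) (t : I) : Set Ω :=
  {ω | ∀ r ≤ t, M.X r ω ∉ B r}

/-- The σ-algebra generated by the whole path. -/
abbrev pathSpace (M : MarkovFamily I E Ω) : MeasurableSpace Ω :=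
  MeasurableSpace.comap (fun ω t => M.X t ω) MeasurableSpace.pi

section Hitting

variable (M : MarkovFamily I E Ω) (B : I → Set E)

theorem hit_le {ω : Ω} {r : I} (h : M.X r ω ∈ B r) : M.hit B ω ≤ ((r : ℝ≥0) : ℝ≥0∞) :=
  iInf₂_le r h

theorem hit_lt_iff {ω : Ω} {t : ℝ≥0∞} :
    M.hit B ω < t ↔ ∃ r : I, M.X r ω ∈ B r ∧ ((r : ℝ≥0) : ℝ≥0∞) < t := by
  simp [hit, iInf_lt_iff]

theorem hit_anti {B B' : I → Set E} (h : ∀ t, B' t ⊆ B t) (ω : Ω) :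
    M.hit B ω ≤ M.hit B' ω :=
  iInf_mono fun r => iInf_mono' fun hr => ⟨h r hr, le_rfl⟩

theorem survives_mono {B B' : I → Set E} (h : ∀ t, B' t ⊆ B t) (t : I) :
    M.survives B t ⊆ M.survives B' t :=
  fun ω (hω : _ < _) => hω.trans_le (M.hit_anti h ω)

theorem survives_subset_noHit (t : I) : M.survives B t ⊆ M.noHit B t := by
  intro ω hω r hr hmem
  exact absurd ((M.hit_le B hmem).trans (by exact_mod_cast hr)) (not_le.2 hω)

theorem le_hit_of_mem_noHit {t : I} {ω : Ω} (hω : ω ∈ M.noHit B t) :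
    ((t : ℝ≥0) : ℝ≥0∞) ≤ M.hit B ω := by
  by_contra h
  obtain ⟨r, hr, hrt⟩ := (M.hit_lt_iff B).1 (not_le.1 h)
  exact hω r (by exact_mod_cast hrt.le) hr

theorem noHit_eq (t : I) :
    M.noHit B t = {ω | M.hit B ω < ((t : ℝ≥0) : ℝ≥0∞)}ᶜ ∩ M.X t ⁻¹' (B t)ᶜ := by
  ext ω
  refine ⟨fun h => ⟨fun h' => not_le_of_gt (show M.hit B ω < _ from h')
    (M.le_hit_of_mem_noHit B h), h t le_rfl⟩, fun h r hr hmem => ?_⟩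
  rcases hr.lt_or_eq with hlt | rfl
  · exact h.1 ((M.hit_le B hmem).trans_lt (by exact_mod_cast hlt))
  · exact h.2 hmem

variable {M B} in
-- By `noHit_eq`, avoiding `B` on the closed interval `[0, t]` means that `τ < t` fails and that `X
-- t` itself is outside `B t`; both are known at time `t`. This is what makes `noHit` usable as the
-- past in the Markov property.
theorem HitMeasurable.measurableSet_noHit (h : M.HitMeasurable B) {t : I}
    (hB : MeasurableSet (B t)) : MeasurableSet[M.filtration t] (M.noHit B t) := by
  rw [noHit_eq]
  refine (h t).compl.inter ?_
  have h1 : MeasurableSpace.comap (M.X t) inferInstance ≤ M.filtration t :=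
    le_iSup₂ (f := fun (r : I) (_ : r ≤ t) => MeasurableSpace.comap (M.X r) inferInstance) t le_rfl
  exact h1 _ ⟨_, hB.compl, rfl⟩

theorem filtration_le_pathSpace (t : I) : M.filtration t ≤ M.pathSpace := by
  refine iSup₂_le fun s _ => ?_
  rintro _ ⟨C, hC, rfl⟩
  exact ⟨(fun p : I → E => p s) ⁻¹' C, measurable_pi_apply s hC, rfl⟩

theorem measurable_path : Measurable fun ω t => M.X t ω :=
  measurable_pi_lambda _ M.measurable_X

theorem pathSpace_le : M.pathSpace ≤ ‹MeasurableSpace Ω› := M.measurable_path.comap_le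

theorem measurableSet_pathSpace_preimage (t : I) {C : Set E} (hC : MeasurableSet C) :
    MeasurableSet[M.pathSpace] (M.X t ⁻¹' C) :=
  ⟨(fun p : I → E => p t) ⁻¹' C, measurable_pi_apply t hC, rfl⟩

theorem survives_eq_noHit_of_discrete
    (hI : I = AddMonoidHom.mrange (Nat.castAddMonoidHom ℝ≥0)) (t : I) :
    M.survives B t = M.noHit B t := by
  refine (M.survives_subset_noHit B t).antisymm fun ω hω => ?_
  have hnat : ∀ r : I, ∃ n : ℕ, (r : ℝ≥0) = n := fun r => by
    have := r.2
    simp only [hI, AddMonoidHom.mem_mrange, Nat.coe_castAddMonoidHom] at this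
    exact this.imp fun _ => Eq.symm
  obtain ⟨n, hn⟩ := hnat t
  change _ < M.hit B ω
  refine lt_of_lt_of_le (b := ((n + 1 : ℕ) : ℝ≥0∞)) ?_ (le_iInf₂ fun r hr => ?_)
  · rw [hn]; exact_mod_cast Nat.lt_succ_self n
  · obtain ⟨m, hm⟩ := hnat r
    have h1 : ¬ r ≤ t := fun h => hω r h hr
    have h2 : n < m := by
      have : (t : ℝ≥0) < r := not_le.1 h1
      rw [hn, hm] at this
      exact_mod_cast this
    rw [hm]
    exact_mod_cast h2

variable {M B} in
-- In continuous time `{τ ≤ t}` is the intersection of `{τ < u n}` along `u n ↓ t`. This looks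
-- slightly beyond `t`, so the event is only placed in the σ-algebra of the whole path.
theorem HitMeasurable.measurableSet_survives (hI : IsTimeSet I) (h : M.HitMeasurable B)
    (hB : ∀ t, MeasurableSet (B t)) (t : I) : MeasurableSet[M.pathSpace] (M.survives B t) := by
  rcases hI with hI | hI
  · rw [M.survives_eq_noHit_of_discrete B hI]
    exact M.filtration_le_pathSpace t _ (h.measurableSet_noHit (hB t))
  · obtain ⟨u, -, hu, hlim⟩ := exists_seq_strictAnti_tendsto (t : ℝ≥0)
    have hmem : ∀ r : ℝ≥0, r ∈ I := fun r => hI ▸ AddSubmonoid.mem_top r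
    have : M.survives B t = (⋂ n : ℕ, {ω | M.hit B ω < (((⟨u n, hmem _⟩ : I) : ℝ≥0) : ℝ≥0∞)})ᶜ := by
      ext ω
      simp only [survives, Set.mem_ofPred_eq, Set.mem_compl_iff, Set.mem_iInter]
      rw [← not_le, not_iff_not]
      refine ⟨fun hle n => hle.trans_lt (by exact_mod_cast hu n), fun hlt => ?_⟩
      exact ge_of_tendsto' ((ENNReal.continuous_coe.tendsto _).comp hlim) fun n => (hlt n).le
    rw [this]
    exact (MeasurableSet.iInter fun n => M.filtration_le_pathSpace _ _ (h _)).compl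

theorem hit_le_add_hit_shift (u : I) (ω : Ω) :
    M.hit B ω ≤ (u : ℝ≥0) + M.hit (shiftBoundary B u) (M.shift u ω) := by
  rw [← tsub_le_iff_left]
  refine le_iInf₂ fun r hr => ?_
  rw [tsub_le_iff_left]
  rw [M.X_shift] at hr
  exact (M.hit_le B hr).trans (by simp)

theorem add_hit_shift_le (hI : IsTimeSet I) {u : I} {ω : Ω} (hω : ω ∈ M.noHit B u) :
    (u : ℝ≥0) + M.hit (shiftBoundary B u) (M.shift u ω) ≤ M.hit B ω := by
  refine le_iInf₂ fun r hr => ?_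
  obtain ⟨c, rfl⟩ := hI.exists_add_of_le (le_of_not_ge fun h => hω r h hr)
  have := M.hit_le (shiftBoundary B u) (ω := M.shift u ω) (r := c) (by rwa [M.X_shift])
  push_cast
  gcongr

/-- The identity is exact although the past factor is `noHit` rather than `survives`: if `τ = u`
without a visit up to `u`, the shifted hitting time is zero and the second factor already excludes
the path. -/
theorem survives_add (hI : IsTimeSet I) (u t : I) :
    M.survives B (u + t) =
      M.noHit B u ∩ M.shift u ⁻¹' M.survives (shiftBoundary B u) t := by
  ext ω
  refine ⟨fun h => ⟨fun r hr => M.survives_subset_noHit B _ h r (hr.trans (le_add_right_self u t)), ?_⟩,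
    fun h => ?_⟩
  · have h1 := lt_of_lt_of_le (show _ < _ from h) (M.hit_le_add_hit_shift B u ω)
    push_cast at h1
    exact (ENNReal.add_lt_add_iff_left ENNReal.coe_ne_top).1 h1
  · refine lt_of_lt_of_le ?_ (M.add_hit_shift_le B hI h.1)
    push_cast
    exact (ENNReal.add_lt_add_iff_left ENNReal.coe_ne_top).2 h.2

theorem noHit_add (hI : IsTimeSet I) (u t : I) :
    M.noHit B (u + t) =
      M.noHit B u ∩ M.shift u ⁻¹' M.noHit (shiftBoundary B u) t := by
  ext ω
  refine ⟨fun h => ⟨fun r hr => h r (hr.trans (le_add_right_self u t)), fun r hr => ?_⟩,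
    fun h r hr => ?_⟩
  · rw [M.X_shift]; exact h _ (by gcongr)
  · rcases le_total r u with hru | hru
    · exact h.1 r hru
    · obtain ⟨c, rfl⟩ := hI.exists_add_of_le hru
      have := h.2 c (by simpa using hr)
      rwa [M.X_shift] at this

end Hitting

/-! ### The Markov property in integrated form -/

section Markov

variable (M : MarkovFamily I E Ω)

theorem shift_preimage_measurable (u : I) {Γ : Set Ω} (hΓ : MeasurableSet[M.pathSpace] Γ) :
    MeasurableSet (M.shift u ⁻¹' Γ) := by
  obtain ⟨C, hC, rfl⟩ := hΓ
  have h : Measurable fun ω t => M.X (u + t) ω := measurable_pi_lambda _ fun t => M.measurable_X _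
  convert h hC using 1
  ext ω
  simp [M.X_shift]

theorem kernel_inter_shift (x : E) (u : I) {N Γ : Set Ω} (hN : MeasurableSet[M.filtration u] N)
    (hΓ : MeasurableSet[M.pathSpace] Γ) :
    M.P x (N ∩ M.shift u ⁻¹' Γ) = ∫⁻ ω in N, M.P (M.X u ω) Γ ∂(M.P x) := by
  have hsh := M.shift_preimage_measurable u hΓ
  have hΓ' := M.pathSpace_le _ hΓ
  have hN' := M.filtration.le u _ hN
  have hmeas : Measurable fun ω => (M.P (M.X u ω)).real Γ :=
    ((M.P.measurable_coe hΓ').comp (M.measurable_X u)).ennreal_toReal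
  have key : ∫ ω in N, (M.P (M.X u ω)).real Γ ∂(M.P x) = (M.P x).real (N ∩ M.shift u ⁻¹' Γ) := by
    obtain ⟨C, hC, rfl⟩ := hΓ
    have hset : {ω | (fun t => M.X (u + t) ω) ∈ C} = M.shift u ⁻¹' ((fun ω t => M.X t ω) ⁻¹' C) := by
      ext ω; simp [M.X_shift]
    have h1 := M.markov x u C hC
    rw [hset] at h1
    have h2 := setIntegral_condExp (μ := M.P x) (M.filtration.le u)
      (f := (M.shift u ⁻¹' ((fun ω t => M.X t ω) ⁻¹' C)).indicator fun _ => (1 : ℝ))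
      ((integrable_const _).indicator hsh) hN
    change condExp (M.filtration u) (M.P x) _ =ᵐ[M.P x] _ at h1
    rw [setIntegral_congr_ae hN' (h1.mono fun ω h _ => h)] at h2
    rw [setIntegral_indicator hsh, setIntegral_const] at h2
    simp at h2
    exact h2
  rw [← ENNReal.ofReal_toReal (measure_ne_top (M.P x) _)]
  rw [← Measure.real, ← key, ofReal_integral_eq_lintegral_ofReal]
  · simp
  · exact Integrable.of_bound hmeas.aestronglyMeasurable 1
      (ae_of_all _ fun ω => by simp [abs_of_nonneg measureReal_nonneg])
  · exact ae_of_all _ fun ω => measureReal_nonneg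

theorem law_apply (μ : Measure E) {S : Set Ω} (hS : MeasurableSet S) :
    M.law μ S = ∫⁻ x, M.P x S ∂μ :=
  Measure.bind_apply hS M.P.aemeasurable

theorem law_dirac (x : E) : M.law (Measure.dirac x) = M.P x :=
  Measure.dirac_bind M.P.measurable x

/-- The process on a past event `N` restarts from the law of `X u` restricted to `N`. With `N` a
`noHit` event this restarting law is `step`. -/
theorem law_inter_shift (μ : Measure E) (u : I) {N Γ : Set Ω}
    (hN : MeasurableSet[M.filtration u] N) (hΓ : MeasurableSet[M.pathSpace] Γ) :
    M.law μ (N ∩ M.shift u ⁻¹' Γ) = M.law (((M.law μ).restrict N).map (M.X u)) Γ := by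
  have hsh := M.shift_preimage_measurable u hΓ
  have hΓ' := M.pathSpace_le _ hΓ
  have hN' := M.filtration.le u _ hN
  have hm : Measurable fun ω => M.P (M.X u ω) Γ := (M.P.measurable_coe hΓ').comp (M.measurable_X u)
  rw [M.law_apply _ (hN'.inter hsh), M.law_apply _ hΓ',
    lintegral_map (M.P.measurable_coe hΓ') (M.measurable_X u), ← lintegral_indicator hN', law,
    Measure.lintegral_bind M.P.aemeasurable (hm.indicator hN').aemeasurable]
  refine lintegral_congr fun x => ?_
  rw [lintegral_indicator hN', M.kernel_inter_shift x u hN hΓ]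

theorem law_univ (μ : Measure E) : M.law μ Set.univ = μ Set.univ := by
  simp [M.law_apply μ MeasurableSet.univ]

instance (μ : Measure E) [IsFiniteMeasure μ] : IsFiniteMeasure (M.law μ) :=
  ⟨by rw [law_univ]; exact measure_lt_top μ _⟩

instance (μ : Measure E) [IsProbabilityMeasure μ] : IsProbabilityMeasure (M.law μ) :=
  ⟨by rw [law_univ]; exact measure_univ⟩

/-- The sub-probability law of `X u` on the event that `B` is not visited during `[0, u]`. -/
noncomputable def step (B : I → Set E) (u : I) (μ : Measure E) : Measure E :=
  ((M.law μ).restrict (M.noHit B u)).map (M.X u)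

instance (B : I → Set E) (u : I) (μ : Measure E) [IsFiniteMeasure μ] :
    IsFiniteMeasure (M.step B u μ) := by
  unfold step; infer_instance

end Markov

end MarkovFamily

/-! ### Restarting the killed process; defects and good points -/

namespace MarkovFamily

variable {I : AddSubmonoid ℝ≥0} {E Ω : Type*} [MeasurableSpace E] [MeasurableSpace Ω]

/-- The event that `B` is not visited during `[0, t]` although the hitting time of `B` is `t`. -/
def defect (M : MarkovFamily I E Ω) (B : I → Set E) (t : I) : Set Ω :=
  M.noHit B t \ M.survives B t

/-- The event that `B` is not hit up to time `t` and that `X t ∈ C`. -/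
def survivesIn (M : MarkovFamily I E Ω) (B : I → Set E) (t : I) (C : Set E) : Set Ω :=
  M.survives B t ∩ M.X t ⁻¹' C

/-- The starting points outside `B 0` from which, almost surely, `B` is not hit
without being visited exactly at a positive multiple of `t₀`. -/
def good (M : MarkovFamily I E Ω) (B : I → Set E) (t₀ : I) : Set E :=
  {x | x ∉ B 0 ∧ ∀ k : ℕ, M.P x (M.defect B ((k + 1) • t₀)) = 0}

/-- The standing measurability assumptions on a moving boundary. -/
structure Regular (M : MarkovFamily I E Ω) (B : I → Set E) : Prop where
  timeSet : IsTimeSet I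
  measurableSet : ∀ t, MeasurableSet (B t)
  hitMeasurable : ∀ s, M.HitMeasurable (shiftBoundary B s)

namespace Regular

variable {M : MarkovFamily I E Ω} {B : I → Set E}

theorem shift (h : M.Regular B) (s : I) : M.Regular (shiftBoundary B s) where
  timeSet := h.timeSet
  measurableSet t := h.measurableSet _
  hitMeasurable t := by rw [shiftBoundary_shiftBoundary]; exact h.hitMeasurable _

theorem hitMeasurable_zero (h : M.Regular B) : M.HitMeasurable B := by
  simpa [shiftBoundary_zero] using h.hitMeasurable 0

theorem noHit_filtration (h : M.Regular B) (t : I) : MeasurableSet[M.filtration t] (M.noHit B t) :=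
  h.hitMeasurable_zero.measurableSet_noHit (h.measurableSet t)

theorem noHit (h : M.Regular B) (t : I) : MeasurableSet[M.pathSpace] (M.noHit B t) :=
  M.filtration_le_pathSpace t _ (h.noHit_filtration t)

theorem survives (h : M.Regular B) (t : I) : MeasurableSet[M.pathSpace] (M.survives B t) :=
  h.hitMeasurable_zero.measurableSet_survives h.timeSet h.measurableSet t

theorem defect (h : M.Regular B) (t : I) : MeasurableSet[M.pathSpace] (M.defect B t) :=
  MeasurableSet.diff (h.noHit t) (h.survives t)

theorem survivesIn (h : M.Regular B) (t : I) {C : Set E} (hC : MeasurableSet C) :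
    MeasurableSet[M.pathSpace] (M.survivesIn B t C) :=
  MeasurableSet.inter (h.survives t) (M.measurableSet_pathSpace_preimage t hC)

theorem good (h : M.Regular B) (t₀ : I) : MeasurableSet (M.good B t₀) := by
  have : M.good B t₀ = (B 0)ᶜ ∩ ⋂ k : ℕ, {x | M.P x (M.defect B ((k + 1) • t₀)) = 0} := by
    ext x; simp [MarkovFamily.good]
  rw [this]
  exact (h.measurableSet 0).compl.inter <| MeasurableSet.iInter fun k =>
    measurableSet_eq_fun (M.P.measurable_coe (M.pathSpace_le _ (h.defect _))) measurable_const

theorem law_survivesIn_add (h : M.Regular B) (μ : Measure E) (u t : I) {C : Set E}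
    (hC : MeasurableSet C) :
    M.law μ (M.survivesIn B (u + t) C) =
      M.law (M.step B u μ) (M.survivesIn (shiftBoundary B u) t C) := by
  rw [step, ← M.law_inter_shift μ u (h.noHit_filtration u) ((h.shift u).survivesIn t hC)]
  congr 1
  rw [MarkovFamily.survivesIn, M.survives_add B h.timeSet, Set.inter_assoc]
  congr 1
  ext ω
  simp [MarkovFamily.survivesIn, M.X_shift]

theorem law_defect_add (h : M.Regular B) (μ : Measure E) (u t : I) :
    M.law μ (M.defect B (u + t)) = M.law (M.step B u μ) (M.defect (shiftBoundary B u) t) := by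
  rw [step, ← M.law_inter_shift μ u (h.noHit_filtration u) ((h.shift u).defect t)]
  congr 1
  rw [MarkovFamily.defect, M.survives_add B h.timeSet, M.noHit_add B h.timeSet]
  ext ω
  simp only [MarkovFamily.defect, Set.mem_sdiff, Set.mem_inter_iff, Set.mem_preimage]
  tauto

theorem ae_notMem_step (h : M.Regular B) (μ : Measure E) (u : I) :
    ∀ᵐ x ∂(M.step B u μ), x ∉ B u := by
  rw [step, ae_map_iff (M.measurable_X u).aemeasurable (h.measurableSet u).compl]
  filter_upwards [ae_restrict_mem (M.pathSpace_le _ (h.noHit u))] with ω hω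
  exact hω u le_rfl

/-- A defect of the restarted process is a defect of the original one at the later time `u + (k + 1)
• t₀`. Its probability is an integral over the restarting point, so if it vanishes, almost every
restarting point has null defect. -/
theorem ae_good_step (h : M.Regular B) (μ : Measure E) (u t₀ : I)
    (hμ : ∀ k : ℕ, M.law μ (M.defect B (u + (k + 1) • t₀)) = 0) :
    ∀ᵐ x ∂(M.step B u μ), x ∈ M.good (shiftBoundary B u) t₀ := by
  have h1 : ∀ᵐ x ∂(M.step B u μ), ∀ k : ℕ,
      M.P x (M.defect (shiftBoundary B u) ((k + 1) • t₀)) = 0 := by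
    rw [ae_all_iff]
    intro k
    have hm := M.pathSpace_le _ ((h.shift u).defect ((k + 1) • t₀))
    have h2 := hμ k
    rw [h.law_defect_add, M.law_apply _ hm,
      lintegral_eq_zero_iff (M.P.measurable_coe hm)] at h2
    exact h2
  filter_upwards [h1, h.ae_notMem_step μ u] with x hx hx'
  exact ⟨by simpa [shiftBoundary] using hx', hx⟩

theorem noHit_ae_eq (Q : Measure Ω) (u : I)
    (hQ : Q (M.defect B u) = 0) : M.noHit B u =ᵐ[Q] M.survives B u := by
  refine Filter.EventuallyLE.antisymm ?_ (LE.le.eventuallyLE (M.survives_subset_noHit B u))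
  exact ae_le_set.2 hQ

theorem step_eq (μ : Measure E) [IsFiniteMeasure μ] (u : I)
    (hμ : M.law μ (M.defect B u) = 0) :
    M.step B u μ = M.law μ (M.survives B u) • M.condLaw B (M.law μ) u := by
  rw [step, condLaw, ProbabilityTheory.cond, Measure.map_smul, smul_smul,
    Measure.restrict_congr_set (noHit_ae_eq _ u hμ)]
  by_cases h0 : M.law μ (M.survives B u) = 0
  · rw [Measure.restrict_eq_zero.2 h0]; simp
  · rw [ENNReal.mul_inv_cancel h0 (measure_ne_top _ _), one_smul]

theorem condLaw_apply (h : M.Regular B) (Q : Measure Ω) (t : I) {C : Set E}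
    (hC : MeasurableSet C) :
    M.condLaw B Q t C = (Q (M.survives B t))⁻¹ * Q (M.survivesIn B t C) := by
  rw [condLaw, Measure.map_apply (M.measurable_X t) hC,
    ProbabilityTheory.cond_apply (M.pathSpace_le _ (h.survives t))]
  rfl

theorem condLaw_real (h : M.Regular B) (Q : Measure Ω) (t : I) {C : Set E}
    (hC : MeasurableSet C) :
    (M.condLaw B Q t).real C = Q.real (M.survivesIn B t C) / Q.real (M.survives B t) := by
  rw [Measure.real, h.condLaw_apply Q t hC, ENNReal.toReal_mul, ENNReal.toReal_inv, mul_comm]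
  rfl

theorem isProbabilityMeasure_condLaw (M : MarkovFamily I E Ω) (B : I → Set E) (Q : Measure Ω)
    [IsFiniteMeasure Q] (t : I) (hQ : Q (M.survives B t) ≠ 0) :
    IsProbabilityMeasure (M.condLaw B Q t) := by
  have := ProbabilityTheory.cond_isProbabilityMeasure hQ
  exact Measure.isProbabilityMeasure_map (M.measurable_X t).aemeasurable

end Regular

theorem law_real (M : MarkovFamily I E Ω) (μ : Measure E) {S : Set Ω} (hS : MeasurableSet S) :
    (M.law μ).real S = ∫ x, (M.P x).real S ∂μ := by
  rw [Measure.real, M.law_apply μ hS]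
  exact (integral_toReal (M.P.measurable_coe hS).aemeasurable
    (ae_of_all _ fun x => measure_lt_top _ _)).symm

theorem measurable_kernel_real (M : MarkovFamily I E Ω) {S : Set Ω} (hS : MeasurableSet S) :
    Measurable fun x => (M.P x).real S :=
  (M.P.measurable_coe hS).ennreal_toReal

theorem integrable_kernel_real (M : MarkovFamily I E Ω) (μ : Measure E) [IsFiniteMeasure μ]
    {S : Set Ω} (hS : MeasurableSet S) : Integrable (fun x => (M.P x).real S) μ :=
  Integrable.of_bound (M.measurable_kernel_real hS).aestronglyMeasurable 1
    (ae_of_all _ fun ω => by simp [abs_of_nonneg measureReal_nonneg])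

theorem survivesIn_univ (M : MarkovFamily I E Ω) (B : I → Set E) (t : I) :
    M.survivesIn B t Set.univ = M.survives B t := by
  simp [survivesIn]

end MarkovFamily

/-! ### Contraction of ratios of integrals under minorization -/

/-- The minorization bounds `∫ F ∂κ` below by `c₁` times the mass of `κ` times `∫ F ∂ν`, and
integrating the comparison of `h` with `∫ h ∂ν` bounds that mass below by `c₂ * ∫ h ∂κ / ∫ h ∂ν`. -/
theorem mul_integral_le_of_minorization {E : Type*} [MeasurableSpace E] {κ ν : Measure E}
    [IsFiniteMeasure κ] [IsProbabilityMeasure ν] {h F : E → ℝ} {c₁ c₂ : ℝ≥0}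
    (hκν : (c₁ * κ Set.univ) • ν ≤ κ) (hF : Integrable F κ) (hF0 : 0 ≤ᵐ[κ] F)
    (hh : Integrable h κ) (hhν : ∀ᵐ x ∂κ, c₂ * h x ≤ ∫ y, h y ∂ν) (hpos : 0 < ∫ y, h y ∂ν)
    (hFν : 0 ≤ ∫ y, F y ∂ν) :
    c₁ * c₂ * ((∫ y, F y ∂ν) / ∫ y, h y ∂ν) * ∫ x, h x ∂κ ≤ ∫ x, F x ∂κ := by
  have h1 : c₁ * κ.real Set.univ * ∫ y, F y ∂ν ≤ ∫ x, F x ∂κ := by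
    have := integral_mono_measure hκν hF0 hF
    rwa [integral_smul_measure, ENNReal.toReal_mul, smul_eq_mul, ENNReal.coe_toReal] at this
  have h2 : c₂ * ∫ x, h x ∂κ ≤ κ.real Set.univ * ∫ y, h y ∂ν := by
    have := integral_mono_ae (hh.const_mul (c₂ : ℝ)) (integrable_const _) hhν
    rwa [integral_const_mul, integral_const, smul_eq_mul] at this
  refine le_trans ?_ h1
  have h3 := mul_le_mul_of_nonneg_left h2
    (mul_nonneg c₁.coe_nonneg (div_nonneg hFν hpos.le))
  calc _ = (c₁ : ℝ) * ((∫ y, F y ∂ν) / ∫ y, h y ∂ν) * (c₂ * ∫ x, h x ∂κ) := by ring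
    _ ≤ _ := h3
    _ = _ := by field_simp

theorem exists_contraction_of_minorization {E : Type*} [MeasurableSpace E] {ν : Measure E}
    [IsProbabilityMeasure ν] {h g : E → ℝ} {c₁ c₂ : ℝ≥0} {a b : ℝ} {G G' : Set E}
    (hhν : ∀ x ∈ G', c₂ * h x ≤ ∫ y, h y ∂ν) (hpos : 0 < ∫ y, h y ∂ν)
    (hh : ∀ κ : Measure E, IsFiniteMeasure κ → Integrable h κ)
    (hg : ∀ κ : Measure E, IsFiniteMeasure κ → Integrable g κ)
    (hab : ∀ x ∈ G, a * h x ≤ g x ∧ g x ≤ b * h x) (hGG' : G ⊆ G') (hc₁ : c₁ ≠ 0) :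
    ∃ a' b' : ℝ, b' - a' = (1 - c₁ * c₂) * (b - a) ∧ ∀ κ : Measure E, IsFiniteMeasure κ →
      κ ≠ 0 → (∀ᵐ x ∂κ, x ∈ G) → (c₁ * κ Set.univ) • ν ≤ κ →
        a' * ∫ x, h x ∂κ ≤ ∫ x, g x ∂κ ∧ ∫ x, g x ∂κ ≤ b' * ∫ x, h x ∂κ := by
  set m := (∫ y, g y ∂ν) / ∫ y, h y ∂ν with hm
  -- Both endpoints move by the fraction `c₁ c₂` towards the ratio `m` under `ν`, which does not
  -- depend on `κ`. The two bounds come from `mul_integral_le_of_minorization` with `F = g - a h`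
  -- and `F = b h - g`.
  refine ⟨a + c₁ * c₂ * (m - a), b - c₁ * c₂ * (b - m), by ring, fun κ _ hκ hG hκν => ?_⟩
  have hhκ := hh κ inferInstance
  have hgκ := hg κ inferInstance
  have hhν' := hh ν inferInstance
  have hgν' := hg ν inferInstance
  -- The signs of `g - a h` and `b h - g` are known `κ`-almost everywhere; domination carries them
  -- over to `ν`.
  have hac : ν ≪ κ := by
    intro S hS
    have h0 := (hκν S).trans hS.le
    simpa [hc₁, hκ] using h0
  have hGκ : ∀ᵐ x ∂κ, c₂ * h x ≤ ∫ y, h y ∂ν := hG.mono fun x hx => hhν x (hGG' hx)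
  have hlo : 0 ≤ᵐ[κ] fun x => g x - a * h x := hG.mono fun x hx => sub_nonneg.2 (hab x hx).1
  have hup : 0 ≤ᵐ[κ] fun x => b * h x - g x := hG.mono fun x hx => sub_nonneg.2 (hab x hx).2
  have e1 := mul_integral_le_of_minorization hκν (hgκ.sub (hhκ.const_mul a)) hlo hhκ hGκ hpos
    (integral_nonneg_of_ae (hac.ae_le hlo))
  have e2 := mul_integral_le_of_minorization hκν ((hhκ.const_mul b).sub hgκ) hup hhκ hGκ hpos
    (integral_nonneg_of_ae (hac.ae_le hup))
  simp only [Pi.sub_apply] at e1 e2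
  rw [integral_sub hgκ (hhκ.const_mul a), integral_sub hgν' (hhν'.const_mul a),
    integral_const_mul, integral_const_mul, sub_div, mul_div_cancel_right₀ _ hpos.ne', ← hm] at e1
  rw [integral_sub (hhκ.const_mul b) hgκ, integral_sub (hhν'.const_mul b) hgν',
    integral_const_mul, integral_const_mul, sub_div, mul_div_cancel_right₀ _ hpos.ne', ← hm] at e2
  constructor <;> linarith

/-! ### Iterating the contraction along multiples of `t₀` -/

namespace MarkovFamily

variable {I : AddSubmonoid ℝ≥0} {E Ω : Type*} [MeasurableSpace E] [MeasurableSpace Ω]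

/-- The data of `MovingCV`, with the constants made explicit, together with positivity of the
survival probabilities. -/
structure Minorized (M : MarkovFamily I E Ω) (B : I → Set E) (ν : I → Measure E) (t₀ : I)
    (c₁ c₂ : ℝ≥0) : Prop extends M.Regular B where
  probOn : ∀ s, IsProbOn (ν s) (B s)ᶜ
  t₀_pos : 0 < t₀
  c₁_pos : 0 < c₁
  c₂_pos : 0 < c₂
  minor : ∀ s, ∀ x ∈ (B s)ᶜ, c₁ • ν (s + t₀) ≤ M.condLaw (shiftBoundary B s) (M.P x) t₀
  compare : ∀ s t, ∀ x ∈ (B s)ᶜ, (c₂ : ℝ≥0∞) * M.P x (M.survives (shiftBoundary B s) t)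
        ≤ M.law (ν s) (M.survives (shiftBoundary B s) t)
  pos : ∀ s t, ∀ x ∈ (B s)ᶜ, 0 < M.P x (M.survives (shiftBoundary B s) t)

namespace Minorized

variable {M : MarkovFamily I E Ω} {B : I → Set E} {ν : I → Measure E} {t₀ : I} {c₁ c₂ : ℝ≥0}

theorem good_subset (M : MarkovFamily I E Ω) (B : I → Set E) (s t₀ : I) :
    M.good (shiftBoundary B s) t₀ ⊆ (B s)ᶜ :=
  fun x hx => by simpa [shiftBoundary] using hx.1

theorem ae_compl (h : M.Minorized B ν t₀ c₁ c₂) (s : I) : ∀ᵐ x ∂(ν s), x ∉ B s := by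
  have := (h.probOn s).1
  exact (mem_ae_iff_prob_eq_one (h.measurableSet s).compl).2 (h.probOn s).2

theorem nonempty_compl (h : M.Minorized B ν t₀ c₁ c₂) (s : I) : ((B s)ᶜ).Nonempty := by
  refine Set.nonempty_iff_ne_empty.2 fun h0 => ?_
  have h1 := (h.probOn s).2
  rw [h0, measure_empty] at h1
  exact zero_ne_one h1

theorem law_pos (h : M.Minorized B ν t₀ c₁ c₂) (s t : I) {μ : Measure E} (hμ : μ ≠ 0)
    (hμB : ∀ᵐ x ∂μ, x ∉ B s) : 0 < M.law μ (M.survives (shiftBoundary B s) t) := by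
  have hm := M.pathSpace_le _ ((h.shift s).survives t)
  rw [pos_iff_ne_zero, M.law_apply _ hm, Ne, lintegral_eq_zero_iff (M.P.measurable_coe hm)]
  intro h0
  apply hμ
  rw [← ae_eq_bot]
  refine Filter.eventually_false_iff_eq_bot.1 ?_
  filter_upwards [h0, hμB] with x hx hx'
  exact (h.pos s t x hx').ne' hx

theorem exists_bounds (h : M.Minorized B ν t₀ c₁ c₂) {C : Set E} (hC : MeasurableSet C) (n : ℕ) :
    ∀ s : I, ∃ a b : ℝ, b - a = (1 - c₁ * c₂ : ℝ) ^ n ∧ ∀ x ∈ M.good (shiftBoundary B s) t₀,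
      a * (M.P x).real (M.survives (shiftBoundary B s) (n • t₀)) ≤
          (M.P x).real (M.survivesIn (shiftBoundary B s) (n • t₀) C) ∧
        (M.P x).real (M.survivesIn (shiftBoundary B s) (n • t₀) C) ≤
          b * (M.P x).real (M.survives (shiftBoundary B s) (n • t₀)) := by
  induction n with
  | zero =>
    refine fun s => ⟨0, 1, by simp, fun x _ => ⟨by simp [measureReal_nonneg], ?_⟩⟩
    rw [one_mul]
    exact measureReal_mono Set.inter_subset_left
  | succ n ih =>
    intro s
    obtain ⟨a, b, hab, hgood⟩ := ih (s + t₀)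
    have hr := h.shift s
    have hr' := h.shift (s + t₀)
    have hprob := (h.probOn (s + t₀)).1
    have hS := M.pathSpace_le _ (hr'.survives (n • t₀))
    have hSC := M.pathSpace_le _ (hr'.survivesIn (n • t₀) hC)
    obtain ⟨a', b', hab', hκ⟩ := exists_contraction_of_minorization (ν := ν (s + t₀))
      (c₁ := c₁) (c₂ := c₂) (G' := (B (s + t₀))ᶜ)
      (fun x hx => by
        rw [← law_real M _ hS]
        have := ENNReal.toReal_mono (measure_ne_top _ _) (h.compare (s + t₀) (n • t₀) x hx)
        simpa [Measure.real] using this)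
      (by
        rw [← law_real M _ hS]
        exact ENNReal.toReal_pos (h.law_pos _ _ (IsProbabilityMeasure.ne_zero _)
          (h.ae_compl _)).ne' (measure_ne_top _ _))
      (fun κ _ => M.integrable_kernel_real κ hS) (fun κ _ => M.integrable_kernel_real κ hSC)
      hgood (good_subset M B _ _) h.c₁_pos.ne'
    refine ⟨a', b', by rw [hab', hab, pow_succ'], fun x hx => ?_⟩
    have hxB : x ∈ (B s)ᶜ := good_subset M B s t₀ hx
    have hd : M.law (Measure.dirac x) (M.defect (shiftBoundary B s) t₀) = 0 := by
      rw [M.law_dirac]; simpa using hx.2 0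
    have hstep := Regular.step_eq (Measure.dirac x) t₀ hd
    rw [M.law_dirac] at hstep
    have hpos := h.pos s t₀ x hxB
    have hcp := Regular.isProbabilityMeasure_condLaw M (shiftBoundary B s) (M.P x) t₀ hpos.ne'
    -- As the defect at `t₀` is null, the restarting law has mass exactly the survival probability,
    -- which is the normalisation in the minorization.
    have huniv : M.step (shiftBoundary B s) t₀ (Measure.dirac x) Set.univ =
        M.P x (M.survives (shiftBoundary B s) t₀) := by
      rw [hstep]; simp
    -- The defect with index `k` after time `t₀` is the defect with index `k + 1` from `x`, so
    -- almost every point reached at `t₀` is good for the boundary shifted by `s + t₀`.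
    have hg := hr.ae_good_step (Measure.dirac x) t₀ t₀ fun k => by
      rw [M.law_dirac]
      have := hx.2 (k + 1)
      rwa [succ_nsmul'] at this
    rw [shiftBoundary_shiftBoundary] at hg
    have key := hκ (M.step (shiftBoundary B s) t₀ (Measure.dirac x)) inferInstance
      (fun h0 => by rw [h0] at huniv; simp at huniv; exact hpos.ne huniv) hg (by
        rw [huniv, hstep, mul_comm, ← smul_smul]
        gcongr
        exact h.minor s x hxB)
    rw [← law_real M _ hS, ← law_real M _ hSC] at key
    have e1 := hr.law_survivesIn_add (Measure.dirac x) t₀ (n • t₀) hC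
    have e2 := hr.law_survivesIn_add (Measure.dirac x) t₀ (n • t₀) MeasurableSet.univ
    rw [M.law_dirac, shiftBoundary_shiftBoundary, ← succ_nsmul'] at e1 e2
    rw [survivesIn_univ, survivesIn_univ] at e2
    simpa only [Measure.real, e1, e2] using key

theorem c₁_le_one (h : M.Minorized B ν t₀ c₁ c₂) : c₁ ≤ 1 := by
  obtain ⟨x, hx⟩ := h.nonempty_compl 0
  have := Regular.isProbabilityMeasure_condLaw M (shiftBoundary B 0) (M.P x) t₀ (h.pos 0 t₀ x hx).ne'
  have := (h.probOn (0 + t₀)).1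
  have := h.minor 0 x hx Set.univ
  rw [Measure.smul_apply, measure_univ, measure_univ, ENNReal.smul_def, smul_eq_mul, mul_one] at this
  exact_mod_cast this

/-- Integrating the comparison at time `0` against `ν 0` gives `c₂ * L ≤ L` with `0 < L < ∞`. -/
theorem c₂_le_one (h : M.Minorized B ν t₀ c₁ c₂) : c₂ ≤ 1 := by
  have hm := M.pathSpace_le _ ((h.shift 0).survives 0)
  have := (h.probOn 0).1
  set L := M.law (ν 0) (M.survives (shiftBoundary B 0) 0) with hL
  have hpos : 0 < L := h.law_pos 0 0 (IsProbabilityMeasure.ne_zero _) (h.ae_compl 0)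
  have hfin : L ≠ ∞ := measure_ne_top _ _
  have key : (c₂ : ℝ≥0∞) * L ≤ 1 * L := by
    calc (c₂ : ℝ≥0∞) * L
        = ∫⁻ x, c₂ * M.P x (M.survives (shiftBoundary B 0) 0) ∂(ν 0) := by
          rw [lintegral_const_mul _ (M.P.measurable_coe hm), ← M.law_apply _ hm]
      _ ≤ ∫⁻ _, L ∂(ν 0) := lintegral_mono_ae <| (h.ae_compl 0).mono fun x hx => h.compare 0 0 x hx
      _ = 1 * L := by simp
  exact_mod_cast (ENNReal.mul_le_mul_iff_left hpos.ne' hfin).1 key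

theorem rate_nonneg (h : M.Minorized B ν t₀ c₁ c₂) : (0 : ℝ) ≤ 1 - c₁ * c₂ :=
  sub_nonneg.2 (mul_le_one₀ (by exact_mod_cast h.c₁_le_one) c₂.coe_nonneg
    (by exact_mod_cast h.c₂_le_one))

theorem rate_lt_one (h : M.Minorized B ν t₀ c₁ c₂) : (1 - c₁ * c₂ : ℝ) < 1 := by
  have h1 : (0 : ℝ) < c₁ := h.c₁_pos
  have h2 : (0 : ℝ) < c₂ := h.c₂_pos
  linarith [mul_pos h1 h2]

theorem tendsto_rate (h : M.Minorized B ν t₀ c₁ c₂) :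
    Tendsto (fun n : ℕ => (1 - c₁ * c₂ : ℝ) ^ n) atTop (𝓝 0) :=
  tendsto_pow_atTop_nhds_zero_of_lt_one h.rate_nonneg h.rate_lt_one

/-- Integrated form of the bounds: they hold for every initial law carried by the good points. -/
theorem exists_law_bounds (h : M.Minorized B ν t₀ c₁ c₂) {C : Set E} (hC : MeasurableSet C) (n : ℕ)
    (s : I) : ∃ a b : ℝ, b - a = (1 - c₁ * c₂ : ℝ) ^ n ∧ ∀ μ : Measure E, IsFiniteMeasure μ →
      μ ≠ 0 → (∀ᵐ x ∂μ, x ∈ M.good (shiftBoundary B s) t₀) →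
      (M.law μ).real (M.survivesIn (shiftBoundary B s) (n • t₀) C) /
        (M.law μ).real (M.survives (shiftBoundary B s) (n • t₀)) ∈ Set.Icc a b := by
  obtain ⟨a, b, hab, hx⟩ := h.exists_bounds hC n s
  refine ⟨a, b, hab, fun μ _ hμ hgood => ?_⟩
  have hS := M.pathSpace_le _ ((h.shift s).survives (n • t₀))
  have hSC := M.pathSpace_le _ ((h.shift s).survivesIn (n • t₀) hC)
  have hpos : 0 < (M.law μ).real (M.survives (shiftBoundary B s) (n • t₀)) :=
    ENNReal.toReal_pos (h.law_pos s _ hμ (hgood.mono fun x hx => good_subset M B s t₀ hx)).ne'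
      (measure_ne_top _ _)
  rw [Set.mem_Icc, le_div_iff₀ hpos, div_le_iff₀ hpos, M.law_real _ hS, M.law_real _ hSC,
    ← integral_const_mul, ← integral_const_mul]
  exact ⟨integral_mono_ae ((M.integrable_kernel_real μ hS).const_mul a)
      (M.integrable_kernel_real μ hSC) (hgood.mono fun x h => (hx x h).1),
    integral_mono_ae (M.integrable_kernel_real μ hSC)
      ((M.integrable_kernel_real μ hS).const_mul b) (hgood.mono fun x h => (hx x h).2)⟩

end Minorized

end MarkovFamily

/-! ### Limits and integrals under uniform convergence on measurable sets -/

section TotalVariation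

variable {E : Type*} [MeasurableSpace E]

theorem exists_isProbabilityMeasure_of_uniform_cauchy (μ : ℕ → Measure E)
    [∀ n, IsProbabilityMeasure (μ n)] {ε : ℕ → ℝ} (hε : Tendsto ε atTop (𝓝 0))
    (hμ : ∀ n m, n ≤ m → ∀ C, MeasurableSet C → |(μ m).real C - (μ n).real C| ≤ ε n) :
    ∃ α : Measure E, IsProbabilityMeasure α ∧
      ∀ n C, MeasurableSet C → |α.real C - (μ n).real C| ≤ ε n := by
  have hlim : ∀ C, MeasurableSet C → ∃ l : ℝ, Tendsto (fun n => (μ n).real C) atTop (𝓝 l) := by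
    refine fun C hC => cauchySeq_tendsto_of_complete <| cauchySeq_of_le_tendsto_0' ε
      (fun n m hnm => ?_) hε
    rw [dist_comm, Real.dist_eq]
    exact hμ n m hnm C hC
  choose! L hL using hlim
  have hL0 : ∀ C, MeasurableSet C → 0 ≤ L C := fun C hC =>
    ge_of_tendsto' (hL C hC) fun n => measureReal_nonneg
  have hbound : ∀ n C, MeasurableSet C → |L C - (μ n).real C| ≤ ε n := fun n C hC =>
    le_of_tendsto (((hL C hC).sub_const _).abs)
      ((eventually_ge_atTop n).mono fun m hm => hμ n m hm C hC)
  -- Finite additivity passes to the limit. Countable additivity follows because `L` is within `ε k`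
  -- of `μ k` on all measurable sets at once: the partial unions and the full union are both
  -- compared with `μ k` for one fixed `k`.
  have hsum : ∀ f : ℕ → Set E, (∀ i, MeasurableSet (f i)) → Pairwise (Function.onFun Disjoint f) →
      HasSum (fun i => L (f i)) (L (⋃ i, f i)) := by
    intro f hf hd
    rw [hasSum_iff_tendsto_nat_of_nonneg fun i => hL0 _ (hf i)]
    have hpart : ∀ n, ∑ i ∈ Finset.range n, L (f i) = L (⋃ i ∈ Finset.range n, f i) := by
      intro n
      refine tendsto_nhds_unique (tendsto_finsetSum _ fun i _ => hL _ (hf i)) ?_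
      refine (hL _ (Finset.measurableSet_biUnion _ fun i _ => hf i)).congr fun k => ?_
      exact measureReal_biUnion_finset (fun i _ j _ hij => hd hij) fun i _ => hf i
    have hk : ∀ k, Tendsto (fun n => (μ k).real (⋃ i ∈ Finset.range n, f i)) atTop
        (𝓝 ((μ k).real (⋃ i, f i))) := by
      intro k
      have hne : ∑' i, μ k (f i) ≠ ∞ := by
        rw [← measure_iUnion hd hf]; exact measure_ne_top _ _
      have h1 := (ENNReal.hasSum_toReal hne).tendsto_sum_nat
      rw [← ENNReal.tsum_toReal_eq fun i => measure_ne_top _ _, ← measure_iUnion hd hf] at h1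
      exact h1.congr fun n =>
        (measureReal_biUnion_finset (fun i _ j _ hij => hd hij) fun i _ => hf i).symm
    rw [Metric.tendsto_atTop]
    intro δ hδ
    obtain ⟨k, hkδ⟩ := (hε.eventually (gt_mem_nhds (show 0 < δ / 3 by positivity))).exists
    obtain ⟨N, hN⟩ := Metric.tendsto_atTop.1 (hk k) (δ / 3) (by positivity)
    refine ⟨N, fun n hn => ?_⟩
    have h1 := hN n hn
    have h2 := hbound k _ (Finset.measurableSet_biUnion (Finset.range n) fun i _ => hf i)
    have h3 := hbound k _ (MeasurableSet.iUnion hf)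
    rw [hpart, Real.dist_eq] at *
    rw [abs_lt] at *
    rw [abs_le] at *
    constructor <;> linarith [h1.1, h1.2, h2.1, h2.2, h3.1, h3.2]
  let α : Measure E := Measure.ofMeasurable (fun C _ => ENNReal.ofReal (L C))
    (by
      have := hL ∅ MeasurableSet.empty
      simp only [measureReal_empty] at this
      simp [tendsto_nhds_unique this tendsto_const_nhds])
    (fun f hf hd => by
      rw [← (hsum f hf hd).tsum_eq,
        ENNReal.ofReal_tsum_of_nonneg (fun i => hL0 _ (hf i)) (hsum f hf hd).summable])
  have hα : ∀ C, MeasurableSet C → α C = ENNReal.ofReal (L C) := fun C hC =>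
    Measure.ofMeasurable_apply C hC
  refine ⟨α, ⟨?_⟩, fun n C hC => ?_⟩
  · have := hL Set.univ MeasurableSet.univ
    simp only [probReal_univ] at this
    rw [hα _ MeasurableSet.univ, tendsto_nhds_unique this tendsto_const_nhds, ENNReal.ofReal_one]
  · rw [Measure.real, hα C hC, ENNReal.toReal_ofReal (hL0 C hC)]
    exact hbound n C hC

/-- By the layer cake formula the integral is that of `m {t < f}` over `t` in `(0, 1]`, an interval
of length one, so the error on sets is the error on integrals. -/
theorem integral_le_integral_add_of_forall_measureReal_le {μ ν : Measure E}
    [IsProbabilityMeasure μ] [IsProbabilityMeasure ν] {ε : ℝ}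
    (hε : ∀ C, MeasurableSet C → μ.real C ≤ ν.real C + ε) {f : E → ℝ} (hf : Measurable f)
    (hf0 : ∀ x, 0 ≤ f x) (hf1 : ∀ x, f x ≤ 1) :
    ∫ x, f x ∂μ ≤ ∫ x, f x ∂ν + ε := by
  have hint : ∀ m : Measure E, IsProbabilityMeasure m → Integrable f m := fun m _ =>
    Integrable.of_bound hf.aestronglyMeasurable 1
      (ae_of_all _ fun x => by rw [Real.norm_of_nonneg (hf0 x)]; exact hf1 x)
  have hlayer : ∀ m : Measure E, IsProbabilityMeasure m →
      ∫ x, f x ∂m = ∫ t in Set.Ioc (0 : ℝ) 1, m.real {a | t < f a} := by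
    intro m hm
    rw [(hint m hm).integral_eq_integral_meas_lt (ae_of_all _ hf0)]
    refine (setIntegral_eq_of_subset_of_forall_sdiff_eq_zero measurableSet_Ioi
      Set.Ioc_subset_Ioi_self fun t ht => ?_)
    have : {a | t < f a} = ∅ := by
      ext a
      have h1 : 1 < t := by
        by_contra h
        exact ht.2 ⟨ht.1, not_lt.1 h⟩
      simp only [Set.mem_ofPred_eq, Set.mem_empty_iff_false, iff_false, not_lt]
      exact (hf1 a).trans h1.le
    simp [this]
  have hi : ∀ m : Measure E, IsProbabilityMeasure m →
      IntegrableOn (fun t : ℝ => m.real {a | t < f a}) (Set.Ioc 0 1) := by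
    intro m hm
    refine Integrable.of_bound (C := 1) ?_ (ae_of_all _ fun x => by
      simp [abs_of_nonneg measureReal_nonneg])
    refine (Antitone.measurable ?_).aestronglyMeasurable
    exact fun s t hst => measureReal_mono fun a (ha : t < f a) => hst.trans_lt ha
  rw [hlayer μ inferInstance, hlayer ν inferInstance]
  calc _ ≤ ∫ t in Set.Ioc (0 : ℝ) 1, (ν.real {a | t < f a} + ε) :=
        setIntegral_mono (hi μ inferInstance) ((hi ν inferInstance).add (integrable_const _))
          fun t => hε _ (measurableSet_lt measurable_const hf)
    _ = _ := by
        rw [integral_add (hi ν inferInstance) (integrable_const _)]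
        simp

theorem abs_integral_sub_le_of_forall_measureReal {μ ν : Measure E}
    [IsProbabilityMeasure μ] [IsProbabilityMeasure ν] {ε : ℝ}
    (hε : ∀ C, MeasurableSet C → |μ.real C - ν.real C| ≤ ε) {f : E → ℝ} (hf : Measurable f)
    {R : ℝ} (hR : 0 < R) (hfR : ∀ x, |f x| ≤ R) :
    |∫ x, f x ∂μ - ∫ x, f x ∂ν| ≤ 2 * R * ε := by
  have hF : Measurable fun x => (f x + R) / (2 * R) := (hf.add_const R).div_const _
  have hF0 : ∀ x, 0 ≤ (f x + R) / (2 * R) := fun x =>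
    div_nonneg (by linarith [(abs_le.1 (hfR x)).1]) (by linarith)
  have hF1 : ∀ x, (f x + R) / (2 * R) ≤ 1 := fun x =>
    (div_le_one (by linarith)).2 (by linarith [(abs_le.1 (hfR x)).2])
  have e : ∀ m : Measure E, IsProbabilityMeasure m →
      ∫ x, (f x + R) / (2 * R) ∂m = (∫ x, f x ∂m + R) / (2 * R) := fun m _ => by
    rw [integral_div, integral_add (Integrable.of_bound hf.aestronglyMeasurable R
      (ae_of_all _ hfR)) (integrable_const _)]
    simp
  have h1 := integral_le_integral_add_of_forall_measureReal_le (μ := μ) (ν := ν) (ε := ε)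
    (fun C hC => by linarith [(abs_le.1 (hε C hC)).2]) hF hF0 hF1
  have h2 := integral_le_integral_add_of_forall_measureReal_le (μ := ν) (ν := μ) (ε := ε)
    (fun C hC => by linarith [(abs_le.1 (hε C hC)).1]) hF hF0 hF1
  rw [e μ inferInstance, e ν inferInstance, ← sub_le_iff_le_add', ← sub_div,
    div_le_iff₀ (by linarith)] at h1 h2
  rw [abs_le]
  constructor <;> linarith

end TotalVariation

/-! ### Null defects and bounds for conditional laws -/

namespace MarkovFamily

variable {I : AddSubmonoid ℝ≥0} {E Ω : Type*} [MeasurableSpace E] [MeasurableSpace Ω]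
  {M : MarkovFamily I E Ω} {B : I → Set E}

theorem noHit_subset_survives {t v : I} (h : v < t) : M.noHit B t ⊆ M.survives B v := fun ω hω =>
  show _ < M.hit B ω from
    lt_of_lt_of_le (by exact_mod_cast h) (M.le_hit_of_mem_noHit B hω)

theorem survives_anti {t v : I} (h : v ≤ t) : M.survives B t ⊆ M.survives B v := fun ω hω =>
  show _ < M.hit B ω from
    lt_of_le_of_lt (by exact_mod_cast h) (show _ < M.hit B ω from hω)

theorem disjoint_defect {t v : I} (h : t ≠ v) : Disjoint (M.defect B t) (M.defect B v) := by
  rw [Set.disjoint_left]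
  intro ω h1 h2
  rcases h.lt_or_gt with h | h
  · exact h1.2 (noHit_subset_survives h h2.1)
  · exact h2.2 (noHit_subset_survives h h1.1)

theorem defect_eq_empty_of_discrete
    (hI : I = AddMonoidHom.mrange (Nat.castAddMonoidHom ℝ≥0)) (t : I) : M.defect B t = ∅ := by
  simp [defect, M.survives_eq_noHit_of_discrete B hI]

namespace Regular

theorem defect_eq_zero_of_le (h : M.Regular B) (Q : Measure Ω) [IsFiniteMeasure Q] {t : I}
    (hQ : Q (M.noHit B t) ≤ Q (M.survives B t)) : Q (M.defect B t) = 0 := by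
  rw [MarkovFamily.defect, measure_sdiff (M.survives_subset_noHit B t)
    (M.pathSpace_le _ (h.survives t)).nullMeasurableSet (measure_ne_top _ _)]
  exact tsub_eq_zero_of_le hQ

/-- For `v < t` avoiding `B` on `[0, t]` forces `τ > v`. Letting `v ↑ t`, which needs `0 < t`,
continuity gives `Q (noHit t) ≤ Q (survives t)`. -/
theorem defect_eq_zero_of_continuous (h : M.Regular B) (Q : Measure Ω) [IsFiniteMeasure Q]
    (hc : Continuous fun t : I => Q (M.survives B t)) {t : I} (ht : 0 < t) :
    Q (M.defect B t) = 0 := by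
  rcases h.timeSet with hI | hI
  · simp [defect_eq_empty_of_discrete hI]
  · have hmem : ∀ r : ℝ≥0, r ∈ I := fun r => (SetLike.ext_iff.1 hI r).2 (AddSubmonoid.mem_top r)
    obtain ⟨u, -, hu, hlim⟩ := exists_seq_strictMono_tendsto' (show (0 : ℝ≥0) < t from ht)
    have hlim' : Tendsto (fun n => (⟨u n, hmem _⟩ : I)) atTop (𝓝 t) := tendsto_subtype_rng.2 hlim
    refine h.defect_eq_zero_of_le Q (ge_of_tendsto' ((hc.tendsto t).comp hlim') fun n => ?_)
    exact measure_mono (noHit_subset_survives (hu n).2)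

theorem condLaw_self (h : M.Regular B) (Q : Measure Ω) (t : I) : M.condLaw B Q t (B t) = 0 := by
  rw [h.condLaw_apply Q t (h.measurableSet t)]
  have : M.survivesIn B t (B t) = ∅ := by
    ext ω
    simp only [MarkovFamily.survivesIn, Set.mem_inter_iff, Set.mem_preimage,
      Set.mem_empty_iff_false, iff_false, not_and]
    exact fun hω => M.survives_subset_noHit B t hω t le_rfl
  simp [this]

theorem law_defect_eq_zero_of_ae (h : M.Regular B) {μ : Measure E} {t : I}
    (hμ : ∀ᵐ x ∂μ, M.P x (M.defect B t) = 0) : M.law μ (M.defect B t) = 0 := by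
  rw [M.law_apply _ (M.pathSpace_le _ (h.defect t)), lintegral_congr_ae hμ]
  simp

theorem law_real_survivesIn_add (h : M.Regular B) (μ : Measure E) (u t : I) {C : Set E}
    (hC : MeasurableSet C) :
    (M.law μ).real (M.survivesIn B (u + t) C) / (M.law μ).real (M.survives B (u + t)) =
      (M.law (M.step B u μ)).real (M.survivesIn (shiftBoundary B u) t C) /
        (M.law (M.step B u μ)).real (M.survives (shiftBoundary B u) t) := by
  have e1 := h.law_survivesIn_add μ u t hC
  have e2 := h.law_survivesIn_add μ u t MeasurableSet.univ
  rw [survivesIn_univ, survivesIn_univ] at e2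
  simp only [Measure.real, e1, e2]

theorem step_ne_zero {μ : Measure E} {u : I}
    (hμ : 0 < M.law μ (M.survives B u)) : M.step B u μ ≠ 0 := by
  intro h0
  have h1 : M.step B u μ Set.univ = M.law μ (M.noHit B u) := by
    simp [step, Measure.map_apply (M.measurable_X u) MeasurableSet.univ]
  rw [h0, Measure.coe_zero, Pi.zero_apply] at h1
  exact (hμ.trans_le (measure_mono (M.survives_subset_noHit B u))).ne h1

end Regular

namespace Minorized

variable {ν : I → Measure E} {t₀ : I} {c₁ c₂ : ℝ≥0}

/-- One interval serves two laws: the one started at a good point against the boundary shifted by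
`s`, and the one started from `μ` and observed at `s + n • t₀`. The second, restarted at `s`, is
again a law carried by good points. -/
theorem exists_condLaw_bounds (h : M.Minorized B ν t₀ c₁ c₂) {C : Set E} (hC : MeasurableSet C)
    (n : ℕ) (s : I) : ∃ a b : ℝ, b - a = (1 - c₁ * c₂ : ℝ) ^ n ∧
      (∀ x ∈ M.good (shiftBoundary B s) t₀,
        (M.condLaw (shiftBoundary B s) (M.P x) (n • t₀)).real C ∈ Set.Icc a b) ∧
      (∀ μ : Measure E, IsFiniteMeasure μ → μ ≠ 0 → (∀ᵐ x ∂μ, x ∉ B 0) →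
        (∀ t > 0, M.law μ (M.defect B t) = 0) →
        (M.condLaw B (M.law μ) (s + n • t₀)).real C ∈ Set.Icc a b) := by
  obtain ⟨a, b, hab, hbd⟩ := h.exists_law_bounds hC n s
  refine ⟨a, b, hab, fun x hx => ?_, fun μ _ hμ hμB hd => ?_⟩
  · have hx' : ∀ᵐ y ∂(Measure.dirac x), y ∈ M.good (shiftBoundary B s) t₀ :=
      (ae_dirac_iff ((h.shift s).good t₀)).2 hx
    have := hbd (Measure.dirac x) inferInstance (IsProbabilityMeasure.ne_zero _) hx'
    rwa [M.law_dirac, ← (h.shift s).condLaw_real _ _ hC] at this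
  · rw [h.condLaw_real _ _ hC, h.law_real_survivesIn_add μ s (n • t₀) hC]
    have hpos := h.law_pos 0 s hμ hμB
    rw [shiftBoundary_zero] at hpos
    refine hbd _ inferInstance (Regular.step_ne_zero hpos) (h.ae_good_step μ s t₀ fun k => hd _ ?_)
    rw [succ_nsmul, ← add_assoc]
    exact lt_of_lt_of_le h.t₀_pos (by rw [add_comm]; exact le_add_right_self _ _)

theorem exists_nsmul_ge (h : M.Minorized B ν t₀ c₁ c₂) (b : I) : ∃ n : ℕ, b ≤ n • t₀ := by
  obtain ⟨n, hn⟩ := Archimedean.arch (b : ℝ≥0) (show (0 : ℝ≥0) < t₀ from h.t₀_pos)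
  exact ⟨n, by simpa [← Subtype.coe_le_coe] using hn⟩

theorem tendsto_nsmul (h : M.Minorized B ν t₀ c₁ c₂) :
    Tendsto (fun n : ℕ => n • t₀) atTop atTop :=
  tendsto_atTop_atTop_of_monotone (fun _ _ hmn => nsmul_le_nsmul_left h.t₀_pos.le hmn)
    h.exists_nsmul_ge

end Minorized

theorem measure_ext_of_real {E : Type*} [MeasurableSpace E] {μ ν : Measure E} [IsFiniteMeasure μ]
    [IsFiniteMeasure ν] (h : ∀ C, MeasurableSet C → μ.real C = ν.real C) : μ = ν :=
  Measure.ext fun C hC => (ENNReal.toReal_eq_toReal_iff' (measure_ne_top _ _)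
    (measure_ne_top _ _)).1 (h C hC)

theorem abs_sub_le_of_mem_Icc {a b x y : ℝ} (hx : x ∈ Set.Icc a b) (hy : y ∈ Set.Icc a b) :
    |x - y| ≤ b - a :=
  abs_sub_le_iff.2 ⟨by linarith [hx.2, hy.1], by linarith [hx.1, hy.2]⟩

theorem law_smul (M : MarkovFamily I E Ω) (c : ℝ≥0∞) (μ : Measure E) :
    M.law (c • μ) = c • M.law μ := by
  ext S hS
  simp [M.law_apply _ hS]

/-! ### Fixed absorbing set: existence of the limit and its quasi-stationarity -/

section Fixed

variable {D : Set E} {ν : Measure E} {t₀ : I} {c₁ c₂ : ℝ≥0}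

theorem Minorized.abs_condLaw_sub_le (h : M.Minorized (fun _ => D) (fun _ => ν) t₀ c₁ c₂)
    {x : E} (hx : x ∉ D) (hd : ∀ t > 0, M.P x (M.defect (fun _ => D) t) = 0)
    {μ : Measure E} [IsFiniteMeasure μ] (hμ0 : μ ≠ 0) (hμ : ∀ᵐ y ∂μ, y ∉ D)
    (hdμ : ∀ t > 0, M.law μ (M.defect (fun _ => D) t) = 0) (n : ℕ) (u : I) {C : Set E}
    (hC : MeasurableSet C) :
    |(M.condLaw (fun _ => D) (M.law μ) (u + n • t₀)).real C -
      (M.condLaw (fun _ => D) (M.P x) (n • t₀)).real C| ≤ (1 - c₁ * c₂ : ℝ) ^ n := by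
  obtain ⟨a, b, hab, h1, h2⟩ := h.exists_condLaw_bounds hC n u
  rw [← hab]
  refine abs_sub_le_of_mem_Icc (h2 μ inferInstance hμ0 hμ hdμ) (h1 x ⟨hx, fun k => hd _ ?_⟩)
  exact nsmul_pos h.t₀_pos (Nat.succ_ne_zero k)

theorem Minorized.exists_limit (h : M.Minorized (fun _ => D) (fun _ => ν) t₀ c₁ c₂)
    {x : E} (hx : x ∉ D) (hd : ∀ t > 0, M.P x (M.defect (fun _ => D) t) = 0) :
    ∃ α : Measure E, IsProbabilityMeasure α ∧ α D = 0 ∧ ∀ (n : ℕ) (u : I) (C : Set E),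
      MeasurableSet C → |(M.condLaw (fun _ => D) (M.P x) (u + n • t₀)).real C - α.real C| ≤
        2 * (1 - c₁ * c₂ : ℝ) ^ n := by
  have hxB : ∀ᵐ y ∂(Measure.dirac x), y ∉ D :=
    (ae_dirac_iff (h.measurableSet 0).compl).2 hx
  have hc : ∀ (n : ℕ) (u : I) (C : Set E), MeasurableSet C →
      |(M.condLaw (fun _ => D) (M.P x) (u + n • t₀)).real C -
        (M.condLaw (fun _ => D) (M.P x) (n • t₀)).real C| ≤ (1 - c₁ * c₂ : ℝ) ^ n := by
    intro n u C hC
    have := h.abs_condLaw_sub_le hx hd (IsProbabilityMeasure.ne_zero _) hxB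
      (by rwa [M.law_dirac]) n u hC
    rwa [M.law_dirac] at this
  have hprob : ∀ n : ℕ, IsProbabilityMeasure (M.condLaw (fun _ => D) (M.P x) (n • t₀)) := fun n =>
    Regular.isProbabilityMeasure_condLaw M _ _ _ (h.pos 0 _ x hx).ne'
  obtain ⟨α, hα, hlim⟩ := exists_isProbabilityMeasure_of_uniform_cauchy
    (fun n : ℕ => M.condLaw (fun _ => D) (M.P x) (n • t₀)) h.tendsto_rate (fun n m hnm C hC => by
      have := hc n ((m - n) • t₀) C hC
      rwa [← add_nsmul, Nat.sub_add_cancel hnm] at this)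
  refine ⟨α, hα, ?_, fun n u C hC => ?_⟩
  · have h0 : ∀ n : ℕ, (M.condLaw (fun _ => D) (M.P x) (n • t₀)).real D = 0 := fun n => by
      have := h.condLaw_self (M.P x) (n • t₀)
      simp [Measure.real, this]
    have h1 : α.real D ≤ 0 := ge_of_tendsto' h.tendsto_rate fun n => by
      have := hlim n D (h.measurableSet 0)
      rw [h0, sub_zero] at this
      exact (le_abs_self _).trans this
    exact (measureReal_eq_zero_iff).1 (h1.antisymm measureReal_nonneg)
  · have h1 := hc n u C hC
    have h2 := hlim n C hC
    rw [abs_le] at *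
    constructor <;> linarith [h1.1, h1.2, h2.1, h2.2]

theorem Minorized.isQuasiStationary_limit (h : M.Minorized (fun _ => D) (fun _ => ν) t₀ c₁ c₂)
    {x : E} (hx : x ∉ D) (hd : ∀ t > 0, M.P x (M.defect (fun _ => D) t) = 0)
    {α : Measure E} [IsProbabilityMeasure α] (hαD : α D = 0)
    (hα : ∀ (n : ℕ) (u : I) (C : Set E), MeasurableSet C →
      |(M.condLaw (fun _ => D) (M.P x) (u + n • t₀)).real C - α.real C| ≤
        2 * (1 - c₁ * c₂ : ℝ) ^ n) :
    M.IsQuasiStationary D α := by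
  intro t
  set B : I → Set E := fun _ => D with hB
  have hrate := h.tendsto_rate.const_mul 2
  rw [mul_zero] at hrate
  have hαD' : ∀ᵐ y ∂α, y ∉ B 0 := measure_eq_zero_iff_ae_notMem.1 hαD
  have hpos : ∀ s, 0 < M.law α (M.survives B s) :=
    fun s => h.law_pos 0 s (IsProbabilityMeasure.ne_zero α) hαD'
  have := Regular.isProbabilityMeasure_condLaw M B (M.law α) t (hpos t).ne'
  have hprob : ∀ n : ℕ, IsProbabilityMeasure (M.condLaw B (M.P x) (n • t₀)) := fun n =>
    Regular.isProbabilityMeasure_condLaw M _ _ _ (h.pos 0 _ x hx).ne'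
  -- The integrand `y ↦ P y S` is bounded and measurable but not assumed continuous, so the uniform
  -- convergence on measurable sets is needed here, not only weak convergence.
  have hlaw : ∀ S, MeasurableSet S → Tendsto (fun n : ℕ =>
      (M.law (M.condLaw B (M.P x) (n • t₀))).real S) atTop (𝓝 ((M.law α).real S)) := by
    intro S hS
    rw [tendsto_iff_dist_tendsto_zero]
    have hr := hrate.const_mul 2
    rw [mul_zero] at hr
    refine squeeze_zero (fun _ => dist_nonneg) (fun n => ?_) hr
    rw [Real.dist_eq, M.law_real _ hS, M.law_real _ hS]
    have := abs_integral_sub_le_of_forall_measureReal (μ := M.condLaw B (M.P x) (n • t₀)) (ν := α)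
      (ε := 2 * (1 - c₁ * c₂ : ℝ) ^ n) (fun C hC => by simpa using hα n 0 C hC)
      (M.measurable_kernel_real hS) one_pos
      (fun y => by simp [abs_of_nonneg measureReal_nonneg])
    simpa using this
  refine measure_ext_of_real fun C hC => ?_
  have h1 : Tendsto (fun n : ℕ => (M.condLaw B (M.P x) (t + n • t₀)).real C) atTop
      (𝓝 (α.real C)) := by
    rw [tendsto_iff_dist_tendsto_zero]
    exact squeeze_zero (fun _ => dist_nonneg) (fun n => hα n t C hC) hrate
  refine tendsto_nhds_unique ?_ h1
  rw [h.condLaw_real _ _ hC]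
  refine ((hlaw _ (M.pathSpace_le _ (h.survivesIn t hC))).div
    (hlaw _ (M.pathSpace_le _ (h.survives t)))
    (ENNReal.toReal_pos (hpos t).ne' (measure_ne_top _ _)).ne').congr' ?_
  -- Restarting at `n • t₀` shows that conditioning at `t + n • t₀` amounts to conditioning at `t`
  -- from the conditional law at `n • t₀`; the survival probability cancels in the ratio. The index
  -- is positive because defects are controlled at positive times only.
  filter_upwards [eventually_gt_atTop 0] with n hn
  have hstep := Regular.step_eq (M := M) (B := B) (Measure.dirac x) (n • t₀)
    (by rw [M.law_dirac]; exact hd _ (nsmul_pos h.t₀_pos hn.ne'))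
  rw [M.law_dirac] at hstep
  have e := h.law_real_survivesIn_add (Measure.dirac x) (n • t₀) t hC
  have hp := (h.pos 0 (n • t₀) x hx).ne'
  have hp' : (M.P x).real (M.survives B (n • t₀)) ≠ 0 :=
    (ENNReal.toReal_pos hp (measure_ne_top _ _)).ne'
  rw [hstep, M.law_smul, M.law_dirac, ← h.condLaw_real _ _ hC, measureReal_ennreal_smul_apply,
    measureReal_ennreal_smul_apply] at e
  rw [add_comm t, e]
  exact (mul_div_mul_left _ _ hp').symm

end Fixed

/-! ### Uniqueness of the quasi-stationary law -/

section QuasiStationary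

variable {D : Set E} {β : Measure E} [IsProbabilityMeasure β]

theorem IsQuasiStationary.law_survives_ne_zero (hβ : M.IsQuasiStationary D β) (t : I) :
    M.law β (M.survives (fun _ => D) t) ≠ 0 := by
  intro h0
  have h1 := hβ t
  rw [condLaw, ProbabilityTheory.cond_eq_zero_of_meas_eq_zero h0, Measure.map_zero] at h1
  exact IsProbabilityMeasure.ne_zero β h1.symm

/-- The restarting law at `u` dominates its part on `{τ > u}`, which by quasi-stationarity is a
multiple of `β`. Equality would need a null defect at `u`, which is not yet known. -/
theorem IsQuasiStationary.mul_le (h : M.Regular fun _ => D) (hβ : M.IsQuasiStationary D β)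
    (u t : I) : M.law β (M.survives (fun _ => D) u) * M.law β (M.survives (fun _ => D) t) ≤
      M.law β (M.survives (fun _ => D) (u + t)) := by
  have hle : M.law β (M.survives (fun _ => D) u) • β ≤ M.step (fun _ => D) u β := by
    nth_rw 2 [← hβ u]
    rw [condLaw, ProbabilityTheory.cond, Measure.map_smul, smul_smul,
      ENNReal.mul_inv_cancel (hβ.law_survives_ne_zero u) (measure_ne_top _ _), one_smul, step]
    exact Measure.map_mono (Measure.restrict_mono (M.survives_subset_noHit _ u) le_rfl)
      (M.measurable_X u)
  have hm := M.pathSpace_le _ (h.survives t)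
  have e := h.law_survivesIn_add β u t MeasurableSet.univ
  rw [survivesIn_univ, survivesIn_univ] at e
  rw [e]
  calc _ = M.law (M.law β (M.survives (fun _ => D) u) • β) (M.survives (fun _ => D) t) := by
        rw [M.law_smul]; rfl
    _ ≤ M.law (M.step (fun _ => D) u β) (M.survives (fun _ => D) t) := by
        rw [M.law_apply _ hm, M.law_apply _ hm]
        exact lintegral_mono' hle le_rfl

/-- With a null defect at `u`, restarting at `u` and then asking for survival at time `0` gives `p =
p * P_β(τ > 0)` with `p = P_β(τ > u)` positive and finite. -/
theorem IsQuasiStationary.law_survives_zero (h : M.Regular fun _ => D)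
    (hβ : M.IsQuasiStationary D β) {u : I} (hu : M.law β (M.defect (fun _ => D) u) = 0) :
    M.law β (M.survives (fun _ => D) 0) = 1 := by
  have e := h.law_survivesIn_add β u 0 MeasurableSet.univ
  rw [survivesIn_univ, survivesIn_univ, Regular.step_eq β u hu, hβ u, M.law_smul, add_zero] at e
  have e' : M.law β (M.survives (fun _ => D) u) * 1 =
      M.law β (M.survives (fun _ => D) u) * M.law β (M.survives (fun _ => D) 0) := by
    rw [mul_one]; exact e
  exact ((ENNReal.mul_right_inj (hβ.law_survives_ne_zero u) (measure_ne_top _ _)).1 e').symm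

/-- Continuity of survival is not assumed under `P_β`. In continuous time some defect is null by a
counting argument, hence `P_β(τ > 0) = 1`. For small `δ`, `noHit v` lies in `{τ > v - δ}`, so
`mul_le` gives `P_β(noHit v) * P_β(τ > δ) ≤ P_β(τ > v)`; now let `δ ↓ 0`. -/
theorem IsQuasiStationary.law_defect (h : M.Regular fun _ => D) (hβ : M.IsQuasiStationary D β)
    {v : I} (hv : 0 < v) : M.law β (M.defect (fun _ => D) v) = 0 := by
  rcases h.timeSet with hI | hI
  · simp [defect_eq_empty_of_discrete hI]
  have hmem : ∀ r : ℝ≥0, r ∈ I := fun r => (SetLike.ext_iff.1 hI r).2 (AddSubmonoid.mem_top r)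
  obtain ⟨u, hu⟩ : ∃ u : I, M.law β (M.defect (fun _ => D) u) = 0 := by
    -- Defects at distinct times are disjoint, so at most countably many have positive mass, while
    -- there are uncountably many times.
    by_contra! hne
    have hcount := Measure.countable_meas_pos_of_disjoint_iUnion (μ := M.law β)
      (As := fun r : ℝ≥0 => M.defect (fun _ => D) (⟨r, hmem r⟩ : I))
      (fun r => M.pathSpace_le _ (h.defect _))
      (fun r r' hr => disjoint_defect fun h' => hr (congrArg Subtype.val h'))
    have huniv : {r : ℝ≥0 | 0 < M.law β (M.defect (fun _ => D) (⟨r, hmem r⟩ : I))} = Set.univ :=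
      Set.eq_univ_of_forall fun r => pos_iff_ne_zero.2 (hne _)
    rw [huniv] at hcount
    have hIoi : (Set.Ioi (0 : ℝ)).Countable := (hcount.image ((↑) : ℝ≥0 → ℝ)).mono fun r hr =>
      (Set.mem_image _ _ _).2 ⟨⟨r, le_of_lt hr⟩, Set.mem_univ _, rfl⟩
    rw [← Cardinal.le_aleph0_iff_set_countable, Cardinal.mk_Ioi_real] at hIoi
    exact Cardinal.aleph0_lt_continuum.not_ge hIoi
  have h0 := hβ.law_survives_zero h hu
  refine h.defect_eq_zero_of_le _ ?_
  obtain ⟨δ, hanti, hδ, hlim⟩ := exists_seq_strictAnti_tendsto' (show (0 : ℝ≥0) < v from hv)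
  have hU : ⋃ n, M.survives (fun _ => D) (⟨δ n, hmem _⟩ : I) = M.survives (fun _ => D) 0 := by
    ext ω
    rw [Set.mem_iUnion]
    refine ⟨fun ⟨n, hn⟩ => survives_anti (hδ n).1.le hn, fun hω => ?_⟩
    have hlim' : Tendsto (fun n => (δ n : ℝ≥0∞)) atTop (𝓝 ((0 : ℝ≥0) : ℝ≥0∞)) :=
      (ENNReal.continuous_coe.tendsto _).comp hlim
    exact (hlim'.eventually (gt_mem_nhds (show _ < M.hit (fun _ => D) ω from hω))).exists
  have hmono : Monotone fun n => M.survives (fun _ => D) (⟨δ n, hmem _⟩ : I) :=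
    fun m n hmn => survives_anti (hanti.antitone hmn)
  have ht := tendsto_measure_iUnion_atTop (μ := M.law β) hmono
  rw [hU, h0] at ht
  have ht' := ENNReal.Tendsto.const_mul (a := M.law β (M.noHit (fun _ => D) v)) ht
    (Or.inl one_ne_zero)
  rw [mul_one] at ht'
  refine le_of_tendsto' ht' fun n => ?_
  obtain ⟨w, hw⟩ := h.timeSet.exists_add_of_le (show (⟨δ n, hmem _⟩ : I) ≤ v from (hδ n).2.le)
  have hwv : w < v := by
    rw [hw]
    exact lt_add_of_pos_left (α := ℝ≥0) _ (hδ n).1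
  calc _ ≤ M.law β (M.survives (fun _ => D) w) *
        M.law β (M.survives (fun _ => D) (⟨δ n, hmem _⟩ : I)) := by
        gcongr
        · exact noHit_subset_survives hwv
        · exact le_rfl
    _ ≤ _ := hβ.mul_le h w _
    _ = _ := by rw [add_comm, ← hw]

theorem IsQuasiStationary.eq_limit {ν : Measure E} {t₀ : I} {c₁ c₂ : ℝ≥0}
    (h : M.Minorized (fun _ => D) (fun _ => ν) t₀ c₁ c₂) (hβ : M.IsQuasiStationary D β)
    {x : E} (hx : x ∉ D) (hd : ∀ t > 0, M.P x (M.defect (fun _ => D) t) = 0)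
    {α : Measure E} [IsProbabilityMeasure α]
    (hα : ∀ (n : ℕ) (u : I) (C : Set E), MeasurableSet C →
      |(M.condLaw (fun _ => D) (M.P x) (u + n • t₀)).real C - α.real C| ≤
        2 * (1 - c₁ * c₂ : ℝ) ^ n) : β = α := by
  have hβD : β D = 0 := by
    have := h.condLaw_self (M.law β) 0
    rwa [hβ 0] at this
  refine measure_ext_of_real fun C hC => ?_
  -- The constant is `1 + 2`: once the rate between the laws from `β` and from `x`, and twice the
  -- rate from there to `α`.
  have hr := h.tendsto_rate.const_mul 3
  rw [mul_zero] at hr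
  have : |β.real C - α.real C| ≤ 0 := ge_of_tendsto' hr fun n => by
    have h1 := h.abs_condLaw_sub_le hx hd (IsProbabilityMeasure.ne_zero β)
      (measure_eq_zero_iff_ae_notMem.1 hβD) (fun t ht => hβ.law_defect h.toRegular ht) n 0 hC
    have h2 := hα n 0 C hC
    rw [hβ] at h1
    rw [zero_add] at h2
    rw [abs_le] at *
    constructor <;> linarith [h1.1, h1.2, h2.1, h2.2]
  exact sub_eq_zero.1 (abs_eq_zero.1 (this.antisymm (abs_nonneg _)))

end QuasiStationary

end MarkovFamily

/-! ### From the moving boundary to its limit -/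

/-- The difference equals `p / P * ((Q - P) / Q) - (q - p) / Q`, and both terms lie between `0` and
`(Q - P) / Q`. It is used with conditional probabilities for nested survival events, uniformly in
the target set. -/
theorem abs_div_sub_div_le {p q P Q : ℝ} (hp : 0 ≤ p) (hpP : p ≤ P) (hP : 0 < P) (hPQ : P ≤ Q)
    (hpq : p ≤ q) (hqp : q - p ≤ Q - P) : |p / P - q / Q| ≤ (Q - P) / Q := by
  have hQ : 0 < Q := hP.trans_le hPQ
  have h1 : p / P - q / Q = p / P * ((Q - P) / Q) - (q - p) / Q := by field_simp; ring
  have h2 : p / P ≤ 1 := (div_le_one hP).2 hpP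
  have h3 : 0 ≤ p / P := div_nonneg hp hP.le
  have h4 : 0 ≤ (Q - P) / Q := div_nonneg (sub_nonneg.2 hPQ) hQ.le
  have h5 : 0 ≤ (q - p) / Q := div_nonneg (sub_nonneg.2 hpq) hQ.le
  have h6 : (q - p) / Q ≤ (Q - P) / Q := by gcongr
  rw [h1, abs_le]
  constructor
  · linarith [mul_nonneg h3 h4]
  · linarith [mul_le_of_le_one_left h4 h2]

theorem weakTendsto_of_forall_measureReal {I : AddSubmonoid ℝ≥0} {E : Type*} [TopologicalSpace E]
    [MeasurableSpace E] [BorelSpace E] {m : I → Measure E} {α : Measure E}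
    [∀ t, IsProbabilityMeasure (m t)] [IsProbabilityMeasure α]
    (h : ∀ ε > 0, ∀ᶠ t in atTop, ∀ C, MeasurableSet C → |(m t).real C - α.real C| ≤ ε) :
    WeakTendsto m α := by
  intro f
  rw [Metric.tendsto_nhds]
  intro δ hδ
  have hR : 0 < ‖f‖ + 1 := by positivity
  filter_upwards [h (δ / (4 * (‖f‖ + 1))) (by positivity)] with t ht
  have h1 := abs_integral_sub_le_of_forall_measureReal ht f.continuous.measurable hR
    (fun x => (f.norm_coe_le_norm x).trans (by linarith))
  rw [Real.dist_eq]
  refine h1.trans_lt ?_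
  have h2 : 2 * (‖f‖ + 1) * (δ / (4 * (‖f‖ + 1))) = δ / 2 := by field_simp; ring
  rw [h2]
  linarith

theorem weakTendsto_unique {I : AddSubmonoid ℝ≥0} {E : Type*} [TopologicalSpace E]
    [HasOuterApproxClosed E] [MeasurableSpace E] [BorelSpace E] {m : I → Measure E}
    {α β : Measure E} [IsFiniteMeasure α] [IsFiniteMeasure β]
    (hα : WeakTendsto m α) (hβ : WeakTendsto m β) : α = β :=
  ext_of_forall_integral_eq_of_IsFiniteMeasure fun f => tendsto_nhds_unique (hα f) (hβ f)

theorem IsProbOn.ae_notMem {E : Type*} [MeasurableSpace E] {μ : Measure E} {F : Set E}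
    (h : IsProbOn μ Fᶜ) (hF : MeasurableSet F) : ∀ᵐ x ∂μ, x ∉ F := by
  have := h.1
  exact (mem_ae_iff_prob_eq_one hF.compl).2 h.2

namespace MarkovFamily

variable {I : AddSubmonoid ℝ≥0} {E Ω : Type*} [MeasurableSpace E] [MeasurableSpace Ω]
  {M : MarkovFamily I E Ω}

/-- If the time horizon in the conditions for a fixed absorbing set is zero, then `Dᶜ` is a
single point, and any positive time horizon does. -/
theorem FixedCV.exists_minorized [MeasurableSingletonClass E] {D : Set E}
    (h : M.FixedCV D) (hreg : M.Regular fun _ => D)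
    (hpos : ∀ t : I, ∀ x ∈ Dᶜ, 0 < M.P x (M.survives (fun _ => D) t)) {t₀ : I} (ht₀ : 0 < t₀) :
    ∃ (ν : Measure E) (t₁ : I) (c₁ c₂ : ℝ≥0),
      M.Minorized (fun _ => D) (fun _ => ν) t₁ c₁ c₂ := by
  obtain ⟨ν, t₁, c₁, c₂, hν, hc₁, hc₂, hmin, hcmp⟩ := h
  have hνp := hν.1
  rcases (show (0 : ℝ≥0) ≤ t₁ from zero_le).lt_or_eq with ht | ht
  · exact ⟨ν, t₁, c₁, c₂, hreg, fun _ => hν, ht, hc₁, hc₂, fun _ => hmin,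
      fun _ => hcmp, fun _ => hpos⟩
  have ht' : t₁ = 0 := Subtype.ext ht.symm
  subst ht'
  -- At horizon `0` the conditional law from `x` is carried by `{x}`, hence so is `ν`, and this for
  -- every `x` outside `D`.
  have hdirac : ∀ x ∈ Dᶜ, ν {x}ᶜ = 0 := by
    intro x hx
    have hstart : M.P x (M.X 0 ⁻¹' {x}ᶜ) = 0 := by
      have h1 := M.start x
      have hms : MeasurableSet (M.X 0 ⁻¹' {x}) := M.measurable_X 0 (measurableSet_singleton x)
      rw [Set.preimage_compl]
      exact (prob_compl_eq_zero_iff hms).2 h1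
    have h1 : M.condLaw (fun _ => D) (M.P x) 0 {x}ᶜ = 0 := by
      rw [hreg.condLaw_apply _ _ (measurableSet_singleton x).compl,
        survivesIn, measure_mono_null Set.inter_subset_right hstart, mul_zero]
    have h2 := (hmin x hx {x}ᶜ).trans h1.le
    rw [Measure.smul_apply, ENNReal.smul_def, smul_eq_mul] at h2
    simpa [hc₁.ne'] using h2
  have hsub : ∀ x ∈ Dᶜ, {x}ᶜ ⊆ D := by
    intro x hx y hy
    by_contra hyD
    have h1 : ν Set.univ ≤ ν {x}ᶜ + ν {y}ᶜ := by
      rw [← Set.univ_subset_iff.1 (show Set.univ ⊆ {x}ᶜ ∪ {y}ᶜ from fun z _ => ?_)]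
      · exact measure_union_le _ _
      · by_cases hz : z = x
        · exact Or.inr fun hzy => hy (by rw [← hz]; exact (Set.mem_singleton_iff.1 hzy).symm)
        · exact Or.inl hz
    rw [hdirac x hx, hdirac y hyD, measure_univ] at h1
    simp at h1
  -- With `Dᶜ = {x}`, a conditional law on survival is carried by `{x}` and so coincides with `ν`;
  -- the constant `1` is therefore admissible at any horizon.
  refine ⟨ν, t₀, 1, c₂, hreg, fun _ => hν, ht₀, one_pos, hc₂, fun _ x hx => ?_,
    fun _ => hcmp, fun _ => hpos⟩
  rw [one_smul]
  have := Regular.isProbabilityMeasure_condLaw M (fun _ => D) (M.P x) t₀ (hpos t₀ x hx).ne'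
  refine Measure.le_iff.2 fun C hC => ?_
  by_cases hxC : x ∈ C
  · have h1 : M.condLaw (fun _ => D) (M.P x) t₀ Cᶜ = 0 :=
      measure_mono_null ((Set.compl_subset_compl.2 (Set.singleton_subset_iff.2 hxC)).trans
        (hsub x hx)) (hreg.condLaw_self _ t₀)
    exact prob_le_one.trans ((prob_compl_eq_zero_iff hC).1 h1).ge
  · rw [measure_mono_null (fun y hy => fun h' => hxC (by rwa [← Set.mem_singleton_iff.1 h']))
      (hdirac x hx)]
    exact zero_le

/-- The portmanteau theorem for the open set `(t, ∞]` gives the lower bound. The upper bound holds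
for each `s`, since `A_∞` is contained in every `A (s + r)` and is thus hit no earlier. -/
theorem tendsto_survives_of_tendstoInDistribution {A : I → Set E} {x : E}
    (h : TendstoInDistribution (fun s : I => M.hit (shiftBoundary A s)) atTop
      (M.hit fun _ => limitSet A) (fun _ => M.P x) (M.P x)) (t : I) :
    Tendsto (fun s => M.P x (M.survives (shiftBoundary A s) t)) atTop
      (𝓝 (M.P x (M.survives (fun _ => limitSet A) t))) := by
  have h1 := ProbabilityMeasure.le_liminf_measure_open_of_tendsto h.tendsto
    (G := Set.Ioi ((t : ℝ≥0) : ℝ≥0∞)) isOpen_Ioi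
  simp only [ProbabilityMeasure.coe_mk, Measure.map_apply_of_aemeasurable (h.forall_aemeasurable _)
    measurableSet_Ioi, Measure.map_apply_of_aemeasurable h.aemeasurable_limit
    measurableSet_Ioi] at h1
  refine tendsto_of_le_liminf_of_limsup_le h1 (limsup_le_of_le (h := .of_forall fun s => ?_))
  exact measure_mono (M.survives_mono (limitSet_subset_shiftBoundary A _) t)

theorem survivesIn_mono {B B' : I → Set E} (h : ∀ t, B' t ⊆ B t) (t : I) (C : Set E) :
    M.survivesIn B t C ⊆ M.survivesIn B' t C :=
  Set.inter_subset_inter_left _ (M.survives_mono h t)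

theorem abs_condLaw_sub_condLaw_le {B B' : I → Set E} (hB : M.Regular B) (hB' : M.Regular B')
    (hsub : ∀ t, B' t ⊆ B t) (Q : Measure Ω) [IsFiniteMeasure Q] (t : I)
    (hQ : 0 < Q.real (M.survives B t)) {C : Set E} (hC : MeasurableSet C) :
    |(M.condLaw B Q t).real C - (M.condLaw B' Q t).real C| ≤
      (Q.real (M.survives B' t) - Q.real (M.survives B t)) / Q.real (M.survives B' t) := by
  rw [hB.condLaw_real _ _ hC, hB'.condLaw_real _ _ hC]
  refine abs_div_sub_div_le measureReal_nonneg (measureReal_mono Set.inter_subset_left) hQ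
    (measureReal_mono (M.survives_mono hsub t)) (measureReal_mono (survivesIn_mono hsub t C)) ?_
  rw [← measureReal_sdiff (survivesIn_mono hsub t C) (M.pathSpace_le _ (hB.survivesIn t hC)),
    ← measureReal_sdiff (M.survives_mono hsub t) (M.pathSpace_le _ (hB.survives t))]
  refine measureReal_mono fun ω hω => ⟨hω.1.1, fun h => hω.2 ⟨h, hω.1.2⟩⟩

theorem Minorized.weakTendsto_condLaw [TopologicalSpace E] [BorelSpace E] {A : I → Set E}
    {ν : I → Measure E} {t₀ : I} {c₁ c₂ : ℝ≥0} (h : M.Minorized A ν t₀ c₁ c₂)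
    (hanti : Antitone A) (hlim : M.Regular fun _ => limitSet A) {x : E} (hx : x ∉ A 0)
    (hhit : TendstoInDistribution (fun s : I => M.hit (shiftBoundary A s)) atTop
      (M.hit fun _ => limitSet A) (fun _ => M.P x) (M.P x))
    (hd : ∀ y ∉ A 0, ∀ s : I, ∀ t > 0, M.P y (M.defect (shiftBoundary A s) t) = 0)
    {α : Measure E} [IsProbabilityMeasure α]
    (hα : ∀ ε > 0, ∀ᶠ t in atTop, ∀ C, MeasurableSet C →
      |(M.condLaw (fun _ => limitSet A) (M.P x) t).real C - α.real C| ≤ ε)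
    {μ : Measure E} (hμ : IsProbOn μ (A 0)ᶜ) : WeakTendsto (M.condLaw A (M.law μ)) α := by
  have hμp := hμ.1
  have hμA := hμ.ae_notMem (h.measurableSet 0)
  have hlawpos : ∀ t, M.law μ (M.survives A t) ≠ 0 := fun t => by
    have := h.law_pos 0 t (IsProbabilityMeasure.ne_zero μ) hμA
    rw [shiftBoundary_zero] at this
    exact this.ne'
  have hprob : ∀ t, IsProbabilityMeasure (M.condLaw A (M.law μ) t) := fun t =>
    Regular.isProbabilityMeasure_condLaw M A _ t (hlawpos t)
  have hxA : ∀ s, x ∉ A s := fun s hxs => hx (hanti (show (0 : ℝ≥0) ≤ s from zero_le) hxs)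
  refine weakTendsto_of_forall_measureReal fun ε hε => ?_
  -- The order of choice matters: `n` is fixed first, so that both the forgetting error and the
  -- distance to `α` at time `n • t₀` are small; only then is `S` taken so large that replacing `A ∘
  -- θ_s` by `A_∞` over this fixed horizon costs less than `ε / 3` for `s ≥ S`.
  obtain ⟨n, hn1, hn2⟩ := ((h.tendsto_rate.eventually
    (gt_mem_nhds (show 0 < ε / 3 by positivity))).and (h.tendsto_nsmul.eventually (hα (ε / 3) (by positivity)))).exists
  have hpD : 0 < (M.P x).real (M.survives (fun _ => limitSet A) (n • t₀)) :=
    ENNReal.toReal_pos ((h.pos 0 _ x hx).trans_le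
      (measure_mono (M.survives_mono (limitSet_subset_shiftBoundary A _) _))).ne' (measure_ne_top _ _)
  have htend : Tendsto (fun s => ((M.P x).real (M.survives (fun _ => limitSet A) (n • t₀)) -
      (M.P x).real (M.survives (shiftBoundary A s) (n • t₀))) /
        (M.P x).real (M.survives (fun _ => limitSet A) (n • t₀))) atTop (𝓝 0) := by
    have h1 := (ENNReal.tendsto_toReal (measure_ne_top _ _)).comp
      (tendsto_survives_of_tendstoInDistribution hhit (n • t₀))
    have h2 := (h1.const_sub ((M.P x).real (M.survives (fun _ => limitSet A) (n • t₀)))).div_const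
      ((M.P x).real (M.survives (fun _ => limitSet A) (n • t₀)))
    rw [← Measure.real, sub_self, zero_div] at h2
    exact h2
  obtain ⟨S, hS⟩ := eventually_atTop.1
    (htend.eventually (gt_mem_nhds (show 0 < ε / 3 by positivity)))
  filter_upwards [eventually_ge_atTop (n • t₀ + S)] with t ht C hC
  obtain ⟨r, rfl⟩ := h.timeSet.exists_add_of_le ht
  obtain ⟨a, b, hab, h1, h2⟩ := h.exists_condLaw_bounds hC n (S + r)
  have e1 := abs_sub_le_of_mem_Icc
    (h2 μ inferInstance (IsProbabilityMeasure.ne_zero μ) hμA fun t ht =>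
      h.law_defect_eq_zero_of_ae (hμA.mono fun y hy => by
        simpa [shiftBoundary_zero] using hd y hy 0 t ht))
    (h1 x ⟨by simpa [shiftBoundary] using hxA (S + r), fun k =>
      hd x hx _ _ (nsmul_pos h.t₀_pos (Nat.succ_ne_zero k))⟩)
  have e2 := abs_condLaw_sub_condLaw_le (h.shift (S + r)) hlim
    (limitSet_subset_shiftBoundary A _) (M.P x) (n • t₀)
    (ENNReal.toReal_pos (h.pos _ _ x (hxA _)).ne' (measure_ne_top _ _)) hC
  have e3 := hS (S + r) (le_add_right_self S r)
  have e4 := hn2 C hC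
  rw [add_assoc, add_comm]
  have e5 := e2.trans e3.le
  rw [hab] at e1
  have e6 := e1.trans hn1.le
  rw [abs_le] at *
  constructor <;> linarith [e4.1, e4.2, e5.1, e5.2, e6.1, e6.2]

end MarkovFamily

/-! ### The main theorem -/

theorem mainTheorem3 {E Ω : Type*} [MetricSpace E] [MeasurableSpace E] [BorelSpace E]
    [MeasurableSpace Ω] (I : AddSubmonoid ℝ≥0) (hI : IsTimeSet I)
    (M : MarkovFamily I E Ω) (A : I → Set E) (hA : ∀ t, MeasurableSet (A t))
    (hmeas : ∀ s, M.HitMeasurable (shiftBoundary A s))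
    (hmeas_lim : M.HitMeasurable fun _ => limitSet A)
    (hfin : ∀ s, ∀ x ∈ (A s)ᶜ, ∀ᵐ ω ∂(M.P x), M.hit (shiftBoundary A s) ω < ∞)
    (hpos : ∀ s t, ∀ x ∈ (A s)ᶜ, 0 < M.P x (M.survives (shiftBoundary A s) t))
    (hanti : Antitone A) (hne : (limitSet A).Nonempty)
    (hCV : M.MovingCV A) (hreg : M.HittingRegularity A) (hCV_lim : M.FixedCV (limitSet A)) :
    ∃ α : ProbabilityMeasure E,
      (α : Measure E) (limitSet A)ᶜ = 1 ∧
      (∀ μ : Measure E, IsProbOn μ (A 0)ᶜ → WeakTendsto (M.condLaw A (M.law μ)) (α : Measure E)) ∧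
      (∀ β : ProbabilityMeasure E, M.IsQuasiLimiting A (β : Measure E) ↔ β = α) ∧
      (∀ β : ProbabilityMeasure E,
        M.IsQuasiStationary (limitSet A) (β : Measure E) ↔ β = α) := by
  have hregA : M.Regular A := ⟨hI, hA, hmeas⟩
  obtain ⟨ν, t₀, c₁, c₂, hν, ht₀, hc₁, hc₂, hmin, hcmp⟩ := hCV
  have hmov : M.Minorized A ν t₀ c₁ c₂ := ⟨hregA, hν, ht₀, hc₁, hc₂, hmin, hcmp, hpos⟩
  have hD : MeasurableSet (limitSet A) := by
    -- The intersection may be uncountable; as `A` decreases, the multiples of `t₀`, being cofinal,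
    -- suffice.
    have : limitSet A = ⋂ n : ℕ, A (n • t₀) :=
      (Set.subset_iInter fun n => Set.iInter_subset A _).antisymm <| Set.subset_iInter fun t => by
        obtain ⟨n, hn⟩ := hmov.exists_nsmul_ge t
        exact (Set.iInter_subset (fun n : ℕ => A (n • t₀)) n).trans (hanti hn)
    rw [this]
    exact MeasurableSet.iInter fun n => hA _
  have hregD : M.Regular fun _ => limitSet A := ⟨hI, fun _ => hD, fun _ => hmeas_lim⟩
  have hposD : ∀ t : I, ∀ x ∈ (limitSet A)ᶜ,
      0 < M.P x (M.survives (fun _ => limitSet A) t) := by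
    intro t x hx
    obtain ⟨s, hs⟩ : ∃ s, x ∉ A s := by simpa [limitSet] using hx
    exact (hpos s t x hs).trans_le
      (measure_mono (M.survives_mono (limitSet_subset_shiftBoundary A s) t))
  obtain ⟨ν', t₁, d₁, d₂, hfix⟩ := hCV_lim.exists_minorized hregD hposD ht₀
  obtain ⟨x, hx⟩ := hmov.nonempty_compl 0
  have hxD : x ∉ limitSet A := fun h => hx (Set.mem_iInter.1 h 0)
  have hd : ∀ t > 0, M.P x (M.defect (fun _ => limitSet A) t) = 0 := fun t ht =>
    hregD.defect_eq_zero_of_continuous _ (hreg.continuous_time_limit x hx) ht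
  obtain ⟨α, hαp, hαD, hα⟩ := hfix.exists_limit hxD hd
  have hαlim : ∀ ε > 0, ∀ᶠ t in atTop, ∀ C, MeasurableSet C →
      |(M.condLaw (fun _ => limitSet A) (M.P x) t).real C - α.real C| ≤ ε := by
    intro ε hε
    have hr := hfix.tendsto_rate.const_mul 2
    rw [mul_zero] at hr
    obtain ⟨n, hn⟩ := (hr.eventually (gt_mem_nhds hε)).exists
    filter_upwards [eventually_ge_atTop (n • t₁)] with t ht C hC
    obtain ⟨u, rfl⟩ := hI.exists_add_of_le ht
    rw [add_comm]
    exact (hα n u C hC).trans hn.le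
  have hconv : ∀ μ : Measure E, IsProbOn μ (A 0)ᶜ → WeakTendsto (M.condLaw A (M.law μ)) α :=
    fun μ hμ => hmov.weakTendsto_condLaw hanti hregD hx (hreg.hit_tendsto x hx)
      (fun y hy s t ht => (hregA.shift s).defect_eq_zero_of_continuous _
        (hreg.continuous_time y hy s) ht) hαlim hμ
  have hqsd := hfix.isQuasiStationary_limit hxD hd hαD hα
  refine ⟨⟨α, hαp⟩, ?_, hconv, fun β => ⟨?_, ?_⟩, fun β => ⟨fun hβ => ?_, ?_⟩⟩
  · exact (prob_compl_eq_one_iff (μ := α) hD).2 hαD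
  · rintro ⟨μ, hμ, hμβ⟩
    have := β.2
    exact Subtype.ext (weakTendsto_unique hμβ (hconv μ hμ))
  · rintro rfl
    exact ⟨ν 0, hν 0, hconv _ (hν 0)⟩
  · have := β.2
    exact Subtype.ext (hβ.eq_limit hfix hxD hd hα)
  · rintro rfl
    exact hqsd
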